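/- Let $n \in \mathbb{N}$ and $1<p<n$, let $B_r \subset \mathbb{R}^n$ be the open ball of radius $r$ centred at the origin, and put $\alpha = \frac{p-1}{np}$. Then $\alpha \in (0,1)$, and there is a constant $C>0$ depending only on $n$ and $p$ such that the following holds. Let $u$ be a bounded weak solution of $\Delta_p u = \operatorname{div}(|\nabla u|^{p-2}\nabla u) = 0$ in $B_4$, that is, $u \in W^{1,p}_{\mathrm{loc}}(B_4) \cap L^\infty(B_4)$ and $\int_{B_4} |\nabla u|^{p-2}\langle \nabla u, \nabla \phi\rangle \, dx = 0$ for all $\phi \in C_c^\infty(B_4)$. If $|\{u \le 0\} \cap B_1| \ge \frac12 |B_1|$, then $$\sup_{B_1} u^+ \le C\, |\{u>0\} \cap B_2|^{\alpha}\, \sup_{B_4} u^+ ,$$ where $u^+ = \max(u,0)$, $|\cdot|$ of a set is Lebesgue measure and $\sup$ is the essential supremum. -/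

import Mathlib

open MeasureTheory Metric
open scoped ContDiff

namespace PLaplace

/-- A smooth test function on `Ω`: an element of `C_c^∞(Ω)`. -/
structure IsTestFunction {n : ℕ} (Ω : Set (EuclideanSpace ℝ (Fin n)))
    (φ : EuclideanSpace ℝ (Fin n) → ℝ) : Prop where
  smooth : ContDiff ℝ ∞ φ
  hasCompactSupport : HasCompactSupport φ
  tsupport_subset : tsupport φ ⊆ Ω

/-- `f ∈ L^p_loc(Ω)`: `f` is in `L^p` on each compact subset of `Ω`. -/
def MemLpLoc {n : ℕ} {F : Type*} [NormedAddCommGroup F] (p : ℝ)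
    (Ω : Set (EuclideanSpace ℝ (Fin n))) (f : EuclideanSpace ℝ (Fin n) → F) : Prop :=
  ∀ K : Set (EuclideanSpace ℝ (Fin n)), K ⊆ Ω → IsCompact K →
    MemLp f (ENNReal.ofReal p) (volume.restrict K)

/-- `u ∈ W^{1,p}_loc(Ω)` with weak gradient `G`: both `u` and `G` are in `L^p_loc(Ω)`, and
`∫_Ω u ∂ᵢφ = - ∫_Ω Gᵢ φ` for each coordinate `i` and each test function `φ`. -/
structure HasWeakGradient {n : ℕ} (p : ℝ) (Ω : Set (EuclideanSpace ℝ (Fin n)))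
    (u : EuclideanSpace ℝ (Fin n) → ℝ)
    (G : EuclideanSpace ℝ (Fin n) → EuclideanSpace ℝ (Fin n)) : Prop where
  memLpLoc : MemLpLoc p Ω u
  memLpLoc_grad : MemLpLoc p Ω G
  integral_eq : ∀ φ : EuclideanSpace ℝ (Fin n) → ℝ, IsTestFunction Ω φ → ∀ i : Fin n,
    ∫ x in Ω, u x * fderiv ℝ φ x (EuclideanSpace.single i 1) = - ∫ x in Ω, G x i * φ x

/-- `u` is a weak solution of `div (|∇u|^{p-2} ∇u) = 0` in `Ω`: it lies in `W^{1,p}_loc(Ω)`, and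
its weak gradient `G` satisfies `∫_Ω |G|^{p-2} ⟨G, ∇φ⟩ = 0` for all test functions `φ`. -/
def IsWeakSolution {n : ℕ} (p : ℝ) (Ω : Set (EuclideanSpace ℝ (Fin n)))
    (u : EuclideanSpace ℝ (Fin n) → ℝ) : Prop :=
  ∃ G : EuclideanSpace ℝ (Fin n) → EuclideanSpace ℝ (Fin n),
    HasWeakGradient p Ω u G ∧
    ∀ φ : EuclideanSpace ℝ (Fin n) → ℝ, IsTestFunction Ω φ →
      ∫ x in Ω, ‖G x‖ ^ (p - 2) * inner ℝ (G x) (gradient φ x) = 0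

/-- `u ∈ L^∞(Ω)`, for measurable `u`: `|u|` has a finite essential bound on `Ω`. -/
def EssBoundedOn {n : ℕ} (Ω : Set (EuclideanSpace ℝ (Fin n)))
    (u : EuclideanSpace ℝ (Fin n) → ℝ) : Prop :=
  ∃ M : ℝ, ∀ᵐ x ∂(volume.restrict Ω), |u x| ≤ M

/-- `sup_A u⁺`, where `u⁺ = max (u, 0)`. Weak solutions are defined up to null sets, so this is
the essential supremum. -/
noncomputable def supPos {n : ℕ} (A : Set (EuclideanSpace ℝ (Fin n)))
    (u : EuclideanSpace ℝ (Fin n) → ℝ) : ℝ :=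
  essSup (fun x => max (u x) 0) (volume.restrict A)

end PLaplace

/-!
The estimate is local boundedness of `p`-subharmonic functions (De Giorgi), with the right-hand
side `‖u⁺‖_{L^q(B_2)}` estimated by `|{u > 0} ∩ B_2|^{1/q} sup u⁺`. Every `q > p` is available; the
choice `q = p + 1` gives the tidiest algebra, and `1/q ≥ α = (p - 1)/(np)` because
`p² - 1 ≤ np`. As `|{u > 0} ∩ B_2| ≤ |B_2|`, the larger exponent `1/q` may be lowered to `α`.

Let `v = (u - k)⁺`. Testing the equation with `ζ v²` bounds `∫ ζ v |∇u|^p` by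
`C (R - r)^{-p} ∫_{B_R} v^q`; the absorption works because the cut-off satisfies
`|∇ζ| ≤ C (R - r)^{-1} ζ^{1 - 1/p}` (`exists_cutoff`). The left-hand side controls the gradient of
`ζ v^{1 + 1/p}` in `L^p` (`integral_norm_gradMulComp_rpow_le`), so the Sobolev inequality and
Hölder's inequality on `{u > k}` give
`∫_{B_r} v^q ≤ C (R - r)^{-p} |{u > k} ∩ B_R|^{p/n} ∫_{B_R} v^q`
(`exists_integral_max_sub_rpow_le`). Along radii decreasing to `1` and levels increasing to `k`,
Chebyshev's inequality turns this into a superlinear recursion, which tends to zero once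
`∫_{B_2} (u⁺)^q` is small compared with `k^q` (`exists_ae_le_of_integral_max_rpow_le`).

Both testing with `ζ F(u)` and applying the Sobolev inequality to it, for `F` of class `C^1`, rest
on one approximation result, `exists_testFunction_tendsto_mul_comp`: mollifying `u` and replacing
`F` by smooth functions gives test functions which converge to `ζ F(u)` almost everywhere and whose
gradients converge in `L^p`.
-/

namespace PLaplace

open Filter Topology ContinuousLinearMap
open scoped ENNReal NNReal Convolution

/-! ### Convergence of mollifications in `L^p` -/

section Mollification

variable {V F : Type*} [NormedAddCommGroup V] [InnerProductSpace ℝ V] [FiniteDimensional ℝ V]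
  [MeasurableSpace V] [BorelSpace V] [NormedAddCommGroup F]

/-- Translation is continuous in `L^q`, `q < ∞`. -/
theorem tendsto_eLpNorm_translate_sub {f : V → F} {q : ℝ≥0∞} (hq : 1 ≤ q) (hq' : q ≠ ⊤)
    (hf : MemLp f q volume) :
    Tendsto (fun t : V => eLpNorm (fun x => f (x - t) - f x) q volume) (𝓝 0) (𝓝 0) := by
  have : Fact (1 ≤ q) := ⟨hq⟩
  have : Fact (q ≠ ⊤) := ⟨hq'⟩
  set g : Lp F q (volume : Measure V) := hf.toLp f with hg
  have hc : Continuous (fun t : V => DomAddAct.mk (-t) +ᵥ g) := by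
    have : Continuous (fun t : V => DomAddAct.mk (-t)) := by
      exact DomAddAct.continuous_mk.comp continuous_neg
    exact this.vadd continuous_const
  have h0 : DomAddAct.mk (-(0 : V)) +ᵥ g = g := by
    simp
  have h1 : Tendsto (fun t : V => edist (DomAddAct.mk (-t) +ᵥ g) g) (𝓝 0) (𝓝 0) := by
    have := (hc.edist (continuous_const (y := g))).tendsto 0
    simpa [h0] using this
  refine h1.congr fun t => ?_
  rw [Lp.edist_def]
  apply eLpNorm_congr_ae
  have e1 := DomAddAct.vadd_Lp_ae_eq (DomAddAct.mk (-t)) g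
  have e2 := hf.coeFn_toLp
  have e3 := (measurePreserving_vadd (-t) (volume : Measure V)).quasiMeasurePreserving.ae_eq_comp e2
  filter_upwards [e1, e2, e3] with x h1 h2 h3
  simp only [Pi.sub_apply]
  rw [h1, h2]
  congr 1
  simp only [Function.comp_def] at h3
  rw [sub_eq_neg_add]
  exact h3

variable [NormedSpace ℝ F]

/-- Minkowski's inequality, in the form of Jensen's inequality followed by Tonelli's theorem: an
average of translates is at most as far from `f` as the farthest translate. -/
theorem eLpNorm_convolution_sub_le [CompleteSpace F] (φ : ContDiffBump (0 : V)) {f : V → F} {p : ℝ}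
    (hp : 1 ≤ p) (hf : MemLp f (ENNReal.ofReal p) volume) {δ : ℝ≥0∞}
    (hδ : ∀ t : V, ‖t‖ < φ.rOut →
      eLpNorm (fun x => f (x - t) - f x) (ENNReal.ofReal p) volume ≤ δ) :
    eLpNorm (fun x => (φ.normed volume ⋆[lsmul ℝ ℝ, volume] f) x - f x)
      (ENNReal.ofReal p) volume ≤ δ := by
  have hp0 : 0 < p := by linarith
  have hP0 : ENNReal.ofReal p ≠ 0 := by simpa using hp0
  have hPt : ENNReal.ofReal p ≠ ⊤ := ENNReal.ofReal_ne_top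
  have hPr : (ENNReal.ofReal p).toReal = p := ENNReal.toReal_ofReal hp0.le
  wlog hsm : StronglyMeasurable f generalizing f with H
  · have hfg : f =ᵐ[volume] hf.1.mk f := hf.1.ae_eq_mk
    have hconv := convolution_congr (lsmul ℝ ℝ) (μ := volume)
      (f := φ.normed volume) (f' := φ.normed volume) (ae_eq_refl _) hfg
    rw [hconv]
    have := H (f := hf.1.mk f) ((memLp_congr_ae hfg).1 hf) (fun t ht => ?_)
      hf.1.stronglyMeasurable_mk
    · refine le_of_eq_of_le (eLpNorm_congr_ae ?_) this
      filter_upwards [hfg] with x hx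
      rw [hx]
    · refine le_of_eq_of_le (eLpNorm_congr_ae ?_) (hδ t ht)
      have h3 := (measurePreserving_sub_right (volume : Measure V) t).quasiMeasurePreserving.ae_eq_comp
        hfg
      filter_upwards [hfg, h3] with x hx hx'
      simp only [Function.comp_def] at hx'
      rw [hx, hx']
  set ρ : V → ℝ := φ.normed volume
  have hρc : Continuous ρ := φ.continuous_normed
  have hρ0 : ∀ x, 0 ≤ ρ x := φ.nonneg_normed
  have hρ1 : ∫⁻ t, ENNReal.ofReal (ρ t) = 1 := by
    rw [← ofReal_integral_eq_lintegral_ofReal φ.integrable_normed (Eventually.of_forall hρ0),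
      φ.integral_normed]; simp
  have hloc : LocallyIntegrable f volume := by
    exact hf.locallyIntegrable (by simpa using hp)
  -- with respect to `ν = ρ dt`, a probability measure, the average is bounded by the `L^p` mean
  set ν : Measure V := volume.withDensity (fun t => ENNReal.ofReal (ρ t)) with hν
  have : IsProbabilityMeasure ν := ⟨by simp [hν, hρ1]⟩
  have hρm : Measurable (fun t => ENNReal.ofReal (ρ t)) := hρc.measurable.ennreal_ofReal
  have hpt : ∀ x, ‖(ρ ⋆[lsmul ℝ ℝ, volume] f) x - f x‖ₑ ^ p
      ≤ ∫⁻ t, ENNReal.ofReal (ρ t) * ‖f (x - t) - f x‖ₑ ^ p := by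
    intro x
    have hsx : StronglyMeasurable (fun t => f (x - t) - f x) :=
      (hsm.comp_measurable (measurable_const.sub measurable_id)).sub stronglyMeasurable_const
    have e1 : (ρ ⋆[lsmul ℝ ℝ, volume] f) x - f x = ∫ t, ρ t • (f (x - t) - f x) := by
      have hce : Integrable (fun t => ρ t • f (x - t)) volume :=
        φ.hasCompactSupport_normed.convolutionExists_left (lsmul ℝ ℝ) hρc hloc x
      simp_rw [smul_sub]
      rw [integral_sub hce (φ.integrable_normed.smul_const _), φ.integral_normed_smul]
      rfl
    have e2 : ‖∫ t, ρ t • (f (x - t) - f x)‖ₑ ≤ eLpNorm (fun t => f (x - t) - f x) 1 ν := by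
      refine (enorm_integral_le_lintegral_enorm _).trans ?_
      rw [eLpNorm_one_eq_lintegral_enorm, hν, lintegral_withDensity_eq_lintegral_mul _ hρm
        hsx.enorm]
      apply lintegral_mono fun t => ?_
      simp only [Pi.mul_apply, enorm_smul, Real.enorm_of_nonneg (hρ0 t)]
      exact le_rfl
    have e3 : eLpNorm (fun t => f (x - t) - f x) 1 ν
        ≤ eLpNorm (fun t => f (x - t) - f x) (ENNReal.ofReal p) ν :=
      eLpNorm_le_eLpNorm_of_exponent_le (by simpa using hp) hsx.aestronglyMeasurable
    rw [e1]
    calc _ ≤ (eLpNorm (fun t => f (x - t) - f x) (ENNReal.ofReal p) ν) ^ p :=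
          ENNReal.rpow_le_rpow (e2.trans e3) hp0.le
      _ = _ := by
        rw [eLpNorm_eq_lintegral_rpow_enorm_toReal hP0 hPt, hPr, ← ENNReal.rpow_mul,
          one_div, inv_mul_cancel₀ hp0.ne', ENNReal.rpow_one, hν,
          lintegral_withDensity_eq_lintegral_mul _ hρm (hsx.enorm.pow_const _)]
        rfl
  have hmeas2 : Measurable (fun z : V × V => ENNReal.ofReal (ρ z.2) * ‖f (z.1 - z.2) - f z.1‖ₑ ^ p) := by
    have : StronglyMeasurable (fun z : V × V => f (z.1 - z.2) - f z.1) :=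
      (hsm.comp_measurable (measurable_fst.sub measurable_snd)).sub
        (hsm.comp_measurable measurable_fst)
    exact (hρm.comp measurable_snd).mul (this.enorm.pow_const _)
  rw [eLpNorm_eq_lintegral_rpow_enorm_toReal hP0 hPt, hPr, one_div]
  rw [ENNReal.rpow_inv_le_iff hp0]
  calc ∫⁻ x, ‖(ρ ⋆[lsmul ℝ ℝ, volume] f) x - f x‖ₑ ^ p
      ≤ ∫⁻ x, ∫⁻ t, ENNReal.ofReal (ρ t) * ‖f (x - t) - f x‖ₑ ^ p := lintegral_mono hpt
    _ = ∫⁻ t, ∫⁻ x, ENNReal.ofReal (ρ t) * ‖f (x - t) - f x‖ₑ ^ p :=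
        lintegral_lintegral_swap hmeas2.aemeasurable
    _ ≤ ∫⁻ t, ENNReal.ofReal (ρ t) * δ ^ p := by
        apply lintegral_mono fun t => ?_
        rw [lintegral_const_mul' _ _ ENNReal.ofReal_ne_top]
        by_cases ht : ‖t‖ < φ.rOut
        · gcongr
          have := hδ t ht
          rwa [eLpNorm_eq_lintegral_rpow_enorm_toReal hP0 hPt, hPr, one_div,
            ENNReal.rpow_inv_le_iff hp0] at this
        · have : ρ t = 0 := by
            rw [← Function.notMem_support, φ.support_normed_eq]
            simpa using ht
          simp [this]
    _ = δ ^ p := by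
        rw [lintegral_mul_const _ hρm, hρ1, one_mul]

theorem tendsto_eLpNorm_convolution_sub [CompleteSpace F] {φ : ℕ → ContDiffBump (0 : V)}
    (hφ : Tendsto (fun j => (φ j).rOut) atTop (𝓝 0)) {f : V → F} {p : ℝ}
    (hp : 1 ≤ p) (hf : MemLp f (ENNReal.ofReal p) volume) :
    Tendsto (fun j => eLpNorm (fun x => ((φ j).normed volume ⋆[lsmul ℝ ℝ, volume] f) x - f x)
      (ENNReal.ofReal p) volume) atTop (𝓝 0) := by
  rw [ENNReal.tendsto_nhds_zero]
  intro δ hδ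
  have h := tendsto_eLpNorm_translate_sub (by simpa using hp) ENNReal.ofReal_ne_top hf
  rw [ENNReal.tendsto_nhds_zero] at h
  obtain ⟨r, hr, h⟩ := Metric.eventually_nhds_iff.1 (h δ hδ)
  filter_upwards [hφ.eventually_lt_const hr] with j hj
  exact eLpNorm_convolution_sub_le (φ j) hp hf fun t ht =>
    h (by simpa using ht.trans hj)

end Mollification

/-! ### Mollification of Sobolev functions -/

section SmoothApproximation

variable {n : ℕ}

theorem gradient_apply_eq_fderiv_single (f : EuclideanSpace ℝ (Fin n) → ℝ)
    (x : EuclideanSpace ℝ (Fin n)) (i : Fin n) :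
    gradient f x i = fderiv ℝ f x (EuclideanSpace.single i 1) := by
  have h : inner ℝ (gradient f x) (EuclideanSpace.single i (1 : ℝ))
      = fderiv ℝ f x (EuclideanSpace.single i 1) := by
    unfold gradient
    rw [InnerProductSpace.toDual_symm_apply]
  rw [← h, EuclideanSpace.inner_single_right]
  simp

/-- Mollification commutes with the weak gradient at points whose distance to the complement of
`K` exceeds the mollification radius; `u` and `G` are cut off outside `K` to make the convolutions
globally defined. -/
theorem gradient_convolution_eq {p : ℝ} (hp : 1 ≤ p) {Ω K : Set (EuclideanSpace ℝ (Fin n))}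
    {u : EuclideanSpace ℝ (Fin n) → ℝ} {G : EuclideanSpace ℝ (Fin n) → EuclideanSpace ℝ (Fin n)}
    (hW : HasWeakGradient p Ω u G) (hK : IsCompact K) (hKΩ : K ⊆ Ω)
    (φ : ContDiffBump (0 : EuclideanSpace ℝ (Fin n))) {x : EuclideanSpace ℝ (Fin n)}
    (hx : closedBall x φ.rOut ⊆ K) :
    gradient (φ.normed volume ⋆[lsmul ℝ ℝ, volume] (K.indicator u)) x
      = (φ.normed volume ⋆[lsmul ℝ ℝ, volume] (K.indicator G)) x := by
  have hKm := hK.measurableSet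
  have hu : LocallyIntegrable (K.indicator u) volume :=
    ((memLp_indicator_iff_restrict hKm).2 (hW.memLpLoc K hKΩ hK)).locallyIntegrable
      (by simpa using hp)
  have hG : LocallyIntegrable (K.indicator G) volume :=
    ((memLp_indicator_iff_restrict hKm).2 (hW.memLpLoc_grad K hKΩ hK)).locallyIntegrable
      (by simpa using hp)
  set ρ : EuclideanSpace ℝ (Fin n) → ℝ := φ.normed volume with hρ
  have hρs : ContDiff ℝ ∞ ρ := φ.contDiff_normed
  have hρ1 : ContDiff ℝ 1 ρ := φ.contDiff_normed
  have hρK : HasCompactSupport ρ := φ.hasCompactSupport_normed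
  have hρz : ∀ t, t ∉ closedBall x φ.rOut → x - t ∉ tsupport ρ := by
    intro t ht
    rw [hρ, φ.tsupport_normed_eq]
    simpa [dist_eq_norm, norm_sub_rev] using ht
  set ψ : EuclideanSpace ℝ (Fin n) → ℝ := fun t => ρ (x - t) with hψ
  have hψt : IsTestFunction Ω ψ := by
    have hsub : tsupport ψ ⊆ closedBall x φ.rOut := by
      apply closure_minimal _ isClosed_closedBall
      intro t ht
      by_contra hc
      exact ht (image_eq_zero_of_notMem_tsupport (f := ρ) (hρz t hc))
    exact ⟨hρs.comp (contDiff_const.sub contDiff_id),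
      HasCompactSupport.of_support_subset_isCompact (isCompact_closedBall x φ.rOut)
        ((subset_tsupport _).trans hsub), hsub.trans (hx.trans hKΩ)⟩
  have hdψ : ∀ t v, fderiv ℝ ψ t v = - fderiv ℝ ρ (x - t) v := by
    intro t v
    have h1 : HasFDerivAt ρ (fderiv ℝ ρ (x - t)) (x - t) :=
      (hρ1.differentiable one_ne_zero _).hasFDerivAt
    have h2 := h1.comp t ((hasFDerivAt_const x t).sub (hasFDerivAt_id t))
    have h3 : fderiv ℝ ψ t = _ := h2.fderiv
    rw [h3]; simp
  ext i
  have hint1 : Integrable (fun t => (precompL (EuclideanSpace ℝ (Fin n)) (lsmul ℝ ℝ))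
      (fderiv ℝ ρ t) (K.indicator u (x - t))) volume :=
    (hρK.fderiv ℝ).convolutionExists_left
      (precompL (EuclideanSpace ℝ (Fin n)) (lsmul ℝ ℝ : ℝ →L[ℝ] ℝ →L[ℝ] ℝ))
      (hρ1.continuous_fderiv one_ne_zero) hu x
  have hint2 : Integrable (fun t => ρ t • (K.indicator G (x - t))) volume :=
    hρK.convolutionExists_left (lsmul ℝ ℝ) hρ1.continuous hG x
  have e1 : gradient (ρ ⋆[lsmul ℝ ℝ, volume] (K.indicator u)) x i
      = ∫ t, fderiv ℝ ρ (x - t) (EuclideanSpace.single i 1) * K.indicator u t := by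
    rw [gradient_apply_eq_fderiv_single,
      (hρK.hasFDerivAt_convolution_left (lsmul ℝ ℝ) hρ1 hu x).fderiv]
    unfold convolution
    rw [ContinuousLinearMap.integral_apply hint1]
    rw [← integral_sub_left_eq_self _ volume x]
    apply integral_congr_ae
    filter_upwards with t
    simp [precompL_apply]
  have e2 : (ρ ⋆[lsmul ℝ ℝ, volume] (K.indicator G)) x i
      = ∫ t, ρ (x - t) * K.indicator G t i := by
    unfold convolution
    have := (EuclideanSpace.proj (𝕜 := ℝ) i : EuclideanSpace ℝ (Fin n) →L[ℝ] ℝ).integral_comp_comm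
      hint2
    simp only [lsmul_apply]
    refine this.symm.trans ?_
    rw [ ← integral_sub_left_eq_self _ volume x]
    apply integral_congr_ae
    filter_upwards with t
    simp
  have key := hW.integral_eq ψ hψt i
  rw [e1, e2]
  -- `ψ` vanishes outside `K`, so the cut-off does not affect the integrals
  have hout : ∀ t, t ∉ K → ψ t = 0 ∧ fderiv ℝ ρ (x - t) = 0 := by
    intro t ht
    have h := hρz t (fun h => ht (hx h))
    exact ⟨image_eq_zero_of_notMem_tsupport (f := ρ) h,
      image_eq_zero_of_notMem_tsupport (fun h' => h (tsupport_fderiv_subset ℝ h'))⟩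
  have s1 : ∫ t in Ω, fderiv ℝ ρ (x - t) (EuclideanSpace.single i 1) * K.indicator u t
      = ∫ t, fderiv ℝ ρ (x - t) (EuclideanSpace.single i 1) * K.indicator u t :=
    setIntegral_eq_integral_of_forall_compl_eq_zero fun t ht => by
      simp [(hout t (fun h => ht (hKΩ h))).2]
  have s2 : ∫ t in Ω, ρ (x - t) * K.indicator G t i = ∫ t, ρ (x - t) * K.indicator G t i :=
    setIntegral_eq_integral_of_forall_compl_eq_zero fun t ht => by
      have : ρ (x - t) = 0 := (hout t (fun h => ht (hKΩ h))).1
      simp [this]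
  have key' : ∫ t in Ω, -(u t * fderiv ℝ ψ t (EuclideanSpace.single i 1))
      = ∫ t in Ω, G t i * ψ t := by
    rw [integral_neg, key, neg_neg]
  rw [← s1, ← s2]
  refine Eq.trans ?_ (key'.trans ?_)
  · apply integral_congr_ae
    filter_upwards with t
    rw [hdψ]
    by_cases ht : t ∈ K
    · simp [ht]; ring
    · simp [(hout t ht).2]
  · apply integral_congr_ae
    filter_upwards with t
    by_cases ht : t ∈ K
    · simp [ht, hψ, mul_comm]
    · have := (hout t ht).1
      simp only [hψ] at this
      simp [this, hψ]

/-- A bounded function of class `W^{1,p}` near the ball `B_3` is the almost everywhere limit on `B_3`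
of smooth functions with the same bound, whose gradients converge in `L^p(B_3)`. -/
theorem exists_smooth_approximation {p : ℝ} (hp : 1 ≤ p)
    {u : EuclideanSpace ℝ (Fin n) → ℝ} {G : EuclideanSpace ℝ (Fin n) → EuclideanSpace ℝ (Fin n)}
    (hW : HasWeakGradient p (ball 0 4) u G) {M : ℝ} (hM0 : 0 ≤ M)
    (hM : ∀ᵐ x ∂(volume.restrict (ball 0 4)), |u x| ≤ M) :
    ∃ U : ℕ → EuclideanSpace ℝ (Fin n) → ℝ, (∀ j, ContDiff ℝ ∞ (U j)) ∧ (∀ j x, |U j x| ≤ M) ∧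
      (∀ᵐ x ∂(volume.restrict (ball 0 3)), Tendsto (fun j => U j x) atTop (𝓝 (u x))) ∧
      Tendsto (fun j => eLpNorm (fun x => gradient (U j) x - G x) (ENNReal.ofReal p)
        (volume.restrict (ball 0 3))) atTop (𝓝 0) := by
  set K : Set (EuclideanSpace ℝ (Fin n)) := closedBall 0 (7 / 2) with hKdef
  have hK : IsCompact K := isCompact_closedBall _ _
  have hKΩ : K ⊆ ball 0 4 := closedBall_subset_ball (by norm_num)
  have hKm := hK.measurableSet
  have h3K : ball (0 : EuclideanSpace ℝ (Fin n)) 3 ⊆ K :=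
    ball_subset_closedBall.trans (closedBall_subset_closedBall (by norm_num))
  have hu := (memLp_indicator_iff_restrict hKm).2 (hW.memLpLoc K hKΩ hK)
  have hG := (memLp_indicator_iff_restrict hKm).2 (hW.memLpLoc_grad K hKΩ hK)
  have hul : LocallyIntegrable (K.indicator u) volume := hu.locallyIntegrable (by simpa using hp)
  have hub : ∀ᵐ x, |K.indicator u x| ≤ M := by
    have := (ae_restrict_iff' measurableSet_ball).1 hM
    filter_upwards [this] with x hx
    by_cases hxK : x ∈ K
    · simpa [hxK] using hx (hKΩ hxK)
    · simpa [hxK] using hM0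
  let φ : ℕ → ContDiffBump (0 : EuclideanSpace ℝ (Fin n)) := fun j =>
    { rIn := 1 / (4 * ((j : ℝ) + 1))
      rOut := 1 / (2 * ((j : ℝ) + 1))
      rIn_pos := by positivity
      rIn_lt_rOut := by
        apply one_div_lt_one_div_of_lt (by positivity)
        have : (0 : ℝ) ≤ j := by positivity
        linarith }
  have hφo : ∀ j, (φ j).rOut = 1 / (2 * ((j : ℝ) + 1)) := fun j => rfl
  have hφi : ∀ j, (φ j).rIn = 1 / (4 * ((j : ℝ) + 1)) := fun j => rfl
  have hφt : Tendsto (fun j => (φ j).rOut) atTop (𝓝 0) := by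
    have := (tendsto_one_div_add_atTop_nhds_zero_nat (𝕜 := ℝ)).const_mul (1 / 2)
    rw [mul_zero] at this
    refine this.congr fun j => ?_
    rw [hφo]; field_simp
  have hφhalf : ∀ j, (φ j).rOut ≤ 1 / 2 := by
    intro j
    rw [hφo]
    apply one_div_le_one_div_of_le (by norm_num)
    have : (0 : ℝ) ≤ j := by positivity
    linarith
  refine ⟨fun j => (φ j).normed volume ⋆[lsmul ℝ ℝ, volume] (K.indicator u), ?_, ?_, ?_, ?_⟩
  · intro j
    exact (φ j).hasCompactSupport_normed.contDiff_convolution_left (lsmul ℝ ℝ)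
      (φ j).contDiff_normed hul
  · intro j x
    unfold convolution
    rw [← Real.norm_eq_abs]
    have hx : ∀ᵐ t, |K.indicator u (x - t)| ≤ M :=
      (Measure.measurePreserving_sub_left volume x).quasiMeasurePreserving.ae hub
    calc _ ≤ ∫ t, (φ j).normed volume t * M := by
          apply norm_integral_le_of_norm_le ((φ j).integrable_normed.mul_const M)
          filter_upwards [hx] with t ht
          simp only [lsmul_apply, norm_smul, Real.norm_eq_abs, abs_of_nonneg ((φ j).nonneg_normed t)]
          exact mul_le_mul_of_nonneg_left ht ((φ j).nonneg_normed t)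
      _ = M := by rw [integral_mul_const, (φ j).integral_normed, one_mul]
  · rw [ae_restrict_iff' measurableSet_ball]
    have := ContDiffBump.ae_convolution_tendsto_right_of_locallyIntegrable (μ := volume)
      (K := 2) hφt (Eventually.of_forall fun j => by
        rw [hφo, hφi]; apply le_of_eq; field_simp; norm_num) hul
    filter_upwards [this] with x hx hx3
    simpa [h3K hx3] using hx
  · have h := tendsto_eLpNorm_convolution_sub hφt hp hG
    refine tendsto_of_tendsto_of_tendsto_of_le_of_le tendsto_const_nhds h (fun _ => zero_le) ?_
    intro j
    refine le_trans (le_of_eq ?_) (eLpNorm_mono_measure _ (Measure.restrict_le_self (s := ball 0 3)))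
    apply eLpNorm_congr_ae
    rw [EventuallyEq, ae_restrict_iff' measurableSet_ball]
    filter_upwards with x hx
    rw [gradient_convolution_eq hp hW hK hKΩ (φ j), Set.indicator_of_mem (h3K hx)]
    apply closedBall_subset_closedBall'
    rw [mem_ball] at hx
    linarith [hφhalf j]

end SmoothApproximation

/-! ### The chain rule -/

section ChainRule

variable {n : ℕ}

/-- A `C^1` function is approximated, together with its derivative, by smooth functions. -/
theorem exists_contDiff_tendsto_deriv {F F' : ℝ → ℝ} (hF : ∀ t, HasDerivAt F (F' t) t)
    (hF' : Continuous F') {ε : ℝ} (hε : 0 < ε) :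
    ∃ P : ℝ → ℝ, ContDiff ℝ ∞ P ∧ (∀ t, |P t - F t| ≤ ε * |t|) ∧
      ∀ t, |deriv P t - F' t| ≤ ε := by
  obtain ⟨g, hg, hgF, -⟩ := hF'.exists_contDiff_approx ⊤ (ε := fun _ => ε) continuous_const
    (fun _ => hε)
  have hgF' : ∀ t, |g t - F' t| ≤ ε := fun t => by
    have := (hgF t).le
    rwa [Real.dist_eq] at this
  have hgc : Continuous g := hg.continuous
  have hder : ∀ t, HasDerivAt (fun t => F 0 + ∫ s in (0 : ℝ)..t, g s) (g t) t := fun t =>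
    (hgc.integral_hasStrictDerivAt 0 t).hasDerivAt.const_add _
  have hd : deriv (fun t => F 0 + ∫ s in (0 : ℝ)..t, g s) = g := funext fun t => (hder t).deriv
  refine ⟨fun t => F 0 + ∫ s in (0 : ℝ)..t, g s, ?_, ?_, ?_⟩
  · rw [contDiff_infty_iff_deriv]
    exact ⟨fun t => (hder t).differentiableAt, by rw [hd]; exact hg⟩
  · intro t
    have := convex_univ.norm_image_sub_le_of_norm_hasDerivWithin_le (C := ε) (x := 0) (y := t)
      (f := fun t => (F 0 + ∫ s in (0 : ℝ)..t, g s) - F t)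
      (fun s _ => ((hder s).sub (hF s)).hasDerivWithinAt) (fun s _ => hgF' s)
      (Set.mem_univ _) (Set.mem_univ _)
    simpa using this
  · intro t
    rw [hd]; exact hgF' t

theorem tendsto_eLpNorm_of_dominated {α E : Type*} [MeasurableSpace α] [NormedAddCommGroup E]
    {μ : Measure α} {p : ℝ} (hp : 0 < p) {f : ℕ → α → E} {g : α → ℝ}
    (hf : ∀ j, AEStronglyMeasurable (f j) μ) (hg : MemLp g (ENNReal.ofReal p) μ)
    (hfg : ∀ j, ∀ᵐ x ∂μ, ‖f j x‖ ≤ g x)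
    (hlim : ∀ᵐ x ∂μ, Tendsto (fun j => f j x) atTop (𝓝 0)) :
    Tendsto (fun j => eLpNorm (f j) (ENNReal.ofReal p) μ) atTop (𝓝 0) := by
  have hP0 : ENNReal.ofReal p ≠ 0 := by simpa using hp
  have hPr : (ENNReal.ofReal p).toReal = p := ENNReal.toReal_ofReal hp.le
  have hfin : ∫⁻ x, ‖g x‖ₑ ^ p ∂μ ≠ ⊤ := by
    have := hg.2
    rw [eLpNorm_lt_top_iff_lintegral_rpow_enorm_lt_top hP0 ENNReal.ofReal_ne_top, hPr] at this
    exact this.ne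
  have h := tendsto_lintegral_of_dominated_convergence' (μ := μ) (F := fun j x => ‖f j x‖ₑ ^ p)
    (f := fun _ => 0) (fun x => ‖g x‖ₑ ^ p) (fun j => (hf j).enorm.pow_const _)
    (fun j => by
      filter_upwards [hfg j] with x hx
      gcongr
      rw [← ofReal_norm, ← ofReal_norm]
      exact ENNReal.ofReal_le_ofReal (hx.trans (le_abs_self _))) hfin
    (by
      filter_upwards [hlim] with x hx
      have h1 : Tendsto (fun j => ‖f j x‖ₑ) atTop (𝓝 0) := by
        simpa using hx.enorm
      have := h1.ennrpow_const p
      rwa [ENNReal.zero_rpow_of_pos hp] at this)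
  have h2 := h.ennrpow_const (1 / p)
  simp only [lintegral_zero] at h2
  rw [ENNReal.zero_rpow_of_pos (by positivity)] at h2
  refine h2.congr fun j => ?_
  rw [eLpNorm_eq_lintegral_rpow_enorm_toReal hP0 ENNReal.ofReal_ne_top, hPr]

/-- The expression which the product and chain rules give for the gradient of `ζ F(u)`, where `G`
is the gradient of `u` and `F'` the derivative of `F`. -/
noncomputable def gradMulComp (ζ u : EuclideanSpace ℝ (Fin n) → ℝ)
    (G : EuclideanSpace ℝ (Fin n) → EuclideanSpace ℝ (Fin n)) (F F' : ℝ → ℝ)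
    (x : EuclideanSpace ℝ (Fin n)) : EuclideanSpace ℝ (Fin n) :=
  F (u x) • gradient ζ x + (ζ x * F' (u x)) • G x

theorem gradient_mul_comp {ζ U : EuclideanSpace ℝ (Fin n) → ℝ} {P : ℝ → ℝ}
    {x : EuclideanSpace ℝ (Fin n)}
    (hζ : DifferentiableAt ℝ ζ x) (hU : DifferentiableAt ℝ U x) (hP : DifferentiableAt ℝ P (U x)) :
    gradient (fun y => ζ y * P (U y)) x = gradMulComp ζ U (gradient U) P (deriv P) x := by
  apply HasGradientAt.gradient
  rw [hasGradientAt_iff_hasFDerivAt]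
  have h := hζ.hasFDerivAt.mul (hP.hasDerivAt.comp_hasFDerivAt x hU.hasFDerivAt)
  refine h.congr_fderiv ?_
  ext v
  simp [gradMulComp, gradient, smul_smul, add_comm]

theorem gradient_eq_zero_of_notMem_tsupport {ζ : EuclideanSpace ℝ (Fin n) → ℝ}
    {x : EuclideanSpace ℝ (Fin n)} (hx : x ∉ tsupport ζ) : gradient ζ x = 0 := by
  have : fderiv ℝ ζ x = 0 :=
    image_eq_zero_of_notMem_tsupport fun h => hx (tsupport_fderiv_subset ℝ h)
  simp [gradient, this]

theorem continuous_gradient {ζ : EuclideanSpace ℝ (Fin n) → ℝ} (hζ : ContDiff ℝ ∞ ζ) :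
    Continuous (gradient ζ) :=
  (InnerProductSpace.toDual ℝ (EuclideanSpace ℝ (Fin n))).symm.continuous.comp
    (hζ.continuous_fderiv (by simp))

theorem IsTestFunction.exists_bound {Ω : Set (EuclideanSpace ℝ (Fin n))}
    {ζ : EuclideanSpace ℝ (Fin n) → ℝ} (hζ : IsTestFunction Ω ζ) :
    ∃ B, ∀ x, |ζ x| ≤ B ∧ ‖gradient ζ x‖ ≤ B := by
  obtain ⟨B1, hB1⟩ := hζ.smooth.continuous.bounded_above_of_compact_support hζ.hasCompactSupport
  obtain ⟨B2, hB2⟩ := (continuous_gradient hζ.smooth).bounded_above_of_compact_support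
    (HasCompactSupport.of_support_subset_isCompact hζ.hasCompactSupport (fun x hx => by
      by_contra h; exact hx (gradient_eq_zero_of_notMem_tsupport h)))
  exact ⟨max B1 B2, fun x => ⟨(hB1 x).trans (le_max_left _ _), (hB2 x).trans (le_max_right _ _)⟩⟩

/-- The chain rule: for `F` of class `C^1` and a cut-off `ζ`, the function `ζ F(u)` is the
almost everywhere limit of test functions, whose gradients converge in `L^p` to `gradMulComp`. -/
theorem exists_testFunction_tendsto_mul_comp {p : ℝ} (hp : 1 ≤ p)
    {u : EuclideanSpace ℝ (Fin n) → ℝ} {G : EuclideanSpace ℝ (Fin n) → EuclideanSpace ℝ (Fin n)}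
    (hW : HasWeakGradient p (ball 0 4) u G) {M : ℝ} (hM0 : 0 ≤ M)
    (hM : ∀ᵐ x ∂(volume.restrict (ball 0 4)), |u x| ≤ M)
    {ζ : EuclideanSpace ℝ (Fin n) → ℝ} (hζ : IsTestFunction (ball 0 3) ζ)
    {F F' : ℝ → ℝ} (hF : ∀ t, HasDerivAt F (F' t) t) (hF' : Continuous F') :
    MemLp (gradMulComp ζ u G F F') (ENNReal.ofReal p) volume ∧
    ∃ Φ : ℕ → EuclideanSpace ℝ (Fin n) → ℝ, (∀ j, IsTestFunction (ball 0 3) (Φ j)) ∧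
      (∀ᵐ x, Tendsto (fun j => Φ j x) atTop (𝓝 (ζ x * F (u x)))) ∧
      Tendsto (fun j => eLpNorm (fun x => gradient (Φ j) x - gradMulComp ζ u G F F' x)
        (ENNReal.ofReal p) volume) atTop (𝓝 0) := by
  have hp0 : 0 < p := by linarith
  have hP1 : 1 ≤ ENNReal.ofReal p := by simpa using hp
  set μ : Measure (EuclideanSpace ℝ (Fin n)) := volume.restrict (ball 0 3) with hμ
  have : IsFiniteMeasure μ := ⟨by rw [hμ, Measure.restrict_apply_univ]; exact measure_ball_lt_top⟩
  have h34 : μ ≤ volume.restrict (ball 0 4) :=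
    Measure.restrict_mono (ball_subset_ball (by norm_num)) le_rfl
  have h3c : closedBall (0 : EuclideanSpace ℝ (Fin n)) 3 ⊆ ball 0 4 :=
    closedBall_subset_ball (by norm_num)
  have huL : MemLp u (ENNReal.ofReal p) μ := (hW.memLpLoc _ h3c (isCompact_closedBall _ _)).mono_measure
    (Measure.restrict_mono ball_subset_closedBall le_rfl)
  have hGL : MemLp G (ENNReal.ofReal p) μ :=
    (hW.memLpLoc_grad _ h3c (isCompact_closedBall _ _)).mono_measure
    (Measure.restrict_mono ball_subset_closedBall le_rfl)
  have huM : ∀ᵐ x ∂μ, |u x| ≤ M := hM.filter_mono (ae_mono h34)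
  have hFc : Continuous F := continuous_iff_continuousAt.2 fun t => (hF t).continuousAt
  obtain ⟨B, hB⟩ := hζ.exists_bound
  have hB0 : 0 ≤ B := (abs_nonneg _).trans (hB 0).1
  obtain ⟨A1, hA1⟩ := (isCompact_Icc (a := -M) (b := M)).exists_bound_of_continuousOn
    hFc.continuousOn
  obtain ⟨A2, hA2⟩ := (isCompact_Icc (a := -M) (b := M)).exists_bound_of_continuousOn
    hF'.continuousOn
  have hA1' : ∀ t, |t| ≤ M → |F t| ≤ A1 := fun t ht => hA1 t (abs_le.1 ht)
  have hA2' : ∀ t, |t| ≤ M → |F' t| ≤ A2 := fun t ht => hA2 t (abs_le.1 ht)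
  have hA10 : 0 ≤ A1 := (abs_nonneg _).trans (hA1' 0 (by simpa using hM0))
  have hA20 : 0 ≤ A2 := (abs_nonneg _).trans (hA2' 0 (by simpa using hM0))
  obtain ⟨U, hUs, hUM, hUlim, hUgrad⟩ := exists_smooth_approximation hp hW hM0 hM
  choose P hPs hPF hPF' using fun j : ℕ => exists_contDiff_tendsto_deriv hF hF'
    (ε := 1 / ((j : ℝ) + 1)) (by positivity)
  have hε : Tendsto (fun j : ℕ => 1 / ((j : ℝ) + 1)) atTop (𝓝 0) :=
    tendsto_one_div_add_atTop_nhds_zero_nat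
  have hε1 : ∀ j : ℕ, 1 / ((j : ℝ) + 1) ≤ 1 := fun j => by
    rw [div_le_one (by positivity)]; have : (0 : ℝ) ≤ j := by positivity
    linarith
  have hPb : ∀ j x, |P j (U j x) - F (U j x)| ≤ 1 / ((j : ℝ) + 1) * M := fun j x =>
    (hPF j _).trans (mul_le_mul_of_nonneg_left (hUM j x) (by positivity))
  set Φ : ℕ → EuclideanSpace ℝ (Fin n) → ℝ := fun j x => ζ x * P j (U j x) with hΦ
  have hΦt : ∀ j, IsTestFunction (ball 0 3) (Φ j) := fun j =>
    ⟨hζ.smooth.mul ((hPs j).comp (hUs j)), hζ.hasCompactSupport.mul_right,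
      (tsupport_mul_subset_left).trans hζ.tsupport_subset⟩
  have hΦg : ∀ j x, gradient (Φ j) x = gradMulComp ζ (U j) (gradient (U j)) (P j) (deriv (P j)) x :=
    fun j x => gradient_mul_comp (hζ.smooth.differentiable (by simp) x)
      ((hUs j).differentiable (by simp) x) ((hPs j).differentiable (by simp) _)
  have hX0 : ∀ x, x ∉ ball 0 3 → gradMulComp ζ u G F F' x = 0 := fun x hx => by
    have h : x ∉ tsupport ζ := fun h => hx (hζ.tsupport_subset h)
    simp [gradMulComp, gradient_eq_zero_of_notMem_tsupport h, image_eq_zero_of_notMem_tsupport h]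
  have hζm : AEStronglyMeasurable ζ μ := hζ.smooth.continuous.aestronglyMeasurable
  have hgm : AEStronglyMeasurable (gradient ζ) μ :=
    (continuous_gradient hζ.smooth).aestronglyMeasurable
  have hFm : AEStronglyMeasurable (fun x => F (u x)) μ := hFc.comp_aestronglyMeasurable huL.1
  have hFm' : AEStronglyMeasurable (fun x => F' (u x)) μ := hF'.comp_aestronglyMeasurable huL.1
  have hXm : AEStronglyMeasurable (gradMulComp ζ u G F F') μ :=
    (hFm.smul hgm).add ((hζm.mul hFm').smul hGL.1)
  have hUlim' : ∀ᵐ x ∂μ, Tendsto (fun j => P j (U j x) - F (u x)) atTop (𝓝 0) ∧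
      Tendsto (fun j => deriv (P j) (U j x) - F' (u x)) atTop (𝓝 0) := by
    filter_upwards [hUlim] with x hx
    have h1 : Tendsto (fun j => P j (U j x) - F (U j x)) atTop (𝓝 0) :=
      squeeze_zero_norm (fun j => hPb j x) (by simpa using hε.mul_const M)
    have h2 : Tendsto (fun j => deriv (P j) (U j x) - F' (U j x)) atTop (𝓝 0) :=
      squeeze_zero_norm (fun j => hPF' j _) hε
    have h3 : Tendsto (fun j => F (U j x) - F (u x)) atTop (𝓝 0) := by
      simpa using ((hFc.tendsto _).comp hx).sub_const (F (u x))
    have h4 : Tendsto (fun j => F' (U j x) - F' (u x)) atTop (𝓝 0) := by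
      simpa using ((hF'.tendsto _).comp hx).sub_const (F' (u x))
    constructor
    · simpa using h1.add h3
    · simpa using h2.add h4
  have hbd : MemLp (fun x => (M + 2 * A1) * B + B * (1 + 2 * A2) * ‖G x‖) (ENNReal.ofReal p) μ := by
    have h1 : MemLp (fun _ : EuclideanSpace ℝ (Fin n) => (M + 2 * A1) * B) (ENNReal.ofReal p) μ :=
      memLp_const _
    have h2 : MemLp (fun x => B * (1 + 2 * A2) * ‖G x‖) (ENNReal.ofReal p) μ :=
      hGL.norm.const_mul _
    exact h1.add h2
  refine ⟨?_, Φ, hΦt, ?_, ?_⟩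
  · have : MemLp (gradMulComp ζ u G F F') (ENNReal.ofReal p) μ := by
      refine hbd.mono hXm ?_
      filter_upwards [huM] with x hx
      refine le_trans ?_ (le_abs_self _)
      refine (norm_add_le _ _).trans (add_le_add ?_ ?_)
      · rw [norm_smul]
        refine mul_le_mul ?_ (hB x).2 (norm_nonneg _) (by positivity)
        exact (hA1' _ hx).trans (by linarith)
      · rw [norm_smul, norm_mul]
        refine mul_le_mul_of_nonneg_right (mul_le_mul (hB x).1 ?_ (norm_nonneg _) hB0)
          (norm_nonneg _)
        exact (hA2' _ hx).trans (by linarith)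
    rw [← memLp_indicator_iff_restrict measurableSet_ball] at this
    rwa [Set.indicator_eq_self.2] at this
    intro x hx
    by_contra h
    exact hx (hX0 x h)
  · have h := (ae_restrict_iff' measurableSet_ball).1 hUlim'
    filter_upwards [h] with x hx
    by_cases hxb : x ∈ ball 0 3
    · have h1 : Tendsto (fun j => P j (U j x)) atTop (𝓝 (F (u x))) := by
        simpa using (hx hxb).1.add_const (F (u x))
      exact h1.const_mul _
    · have h : x ∉ tsupport ζ := fun h => hxb (hζ.tsupport_subset h)
      simp [hΦ, image_eq_zero_of_notMem_tsupport h]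
  · -- the error is a dominated term plus a bounded multiple of `∇U_j - G`
    set R : ℕ → EuclideanSpace ℝ (Fin n) → EuclideanSpace ℝ (Fin n) := fun j x =>
      (P j (U j x) - F (u x)) • gradient ζ x + (ζ x * (deriv (P j) (U j x) - F' (u x))) • G x
      with hR
    set T : ℕ → EuclideanSpace ℝ (Fin n) → EuclideanSpace ℝ (Fin n) := fun j x =>
      (ζ x * deriv (P j) (U j x)) • (gradient (U j) x - G x) with hT
    have hPm : ∀ j, AEStronglyMeasurable (fun x => P j (U j x)) μ := fun j =>
      ((hPs j).continuous.comp (hUs j).continuous).aestronglyMeasurable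
    have hPm' : ∀ j, AEStronglyMeasurable (fun x => deriv (P j) (U j x)) μ := fun j =>
      (((hPs j).continuous_deriv (by simp)).comp (hUs j).continuous).aestronglyMeasurable
    have hRm : ∀ j, AEStronglyMeasurable (R j) μ := fun j =>
      (((hPm j).sub hFm).smul hgm).add ((hζm.mul ((hPm' j).sub hFm')).smul hGL.1)
    have hTm : ∀ j, AEStronglyMeasurable (T j) μ := fun j =>
      (hζm.mul (hPm' j)).smul
        ((continuous_gradient (hUs j)).aestronglyMeasurable.sub hGL.1)
    have hdb : ∀ j x, |deriv (P j) (U j x)| ≤ 1 + A2 := fun j x => by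
      have h1 := (hPF' j (U j x)).trans (hε1 j)
      have h2 := hA2' _ (hUM j x)
      calc |deriv (P j) (U j x)| = |(deriv (P j) (U j x) - F' (U j x)) + F' (U j x)| := by ring_nf
        _ ≤ _ := (abs_add_le _ _).trans (add_le_add h1 h2)
    have hRlim : Tendsto (fun j => eLpNorm (R j) (ENNReal.ofReal p) μ) atTop (𝓝 0) := by
      refine tendsto_eLpNorm_of_dominated hp0 hRm hbd (fun j => ?_) ?_
      · filter_upwards [huM] with x hx
        refine (norm_add_le _ _).trans (add_le_add ?_ ?_)
        · rw [norm_smul]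
          refine mul_le_mul ?_ (hB x).2 (norm_nonneg _) (by positivity)
          have h1 : |P j (U j x) - F (U j x)| ≤ M :=
            (hPb j x).trans (by simpa using mul_le_mul_of_nonneg_right (hε1 j) hM0)
          have h2 := hA1' _ (hUM j x)
          have h3 := hA1' _ hx
          calc ‖P j (U j x) - F (u x)‖
              = ‖(P j (U j x) - F (U j x)) + F (U j x) - F (u x)‖ := by ring_nf
            _ ≤ M + A1 + A1 := (norm_sub_le _ _).trans
                (add_le_add ((norm_add_le _ _).trans (add_le_add h1 h2)) h3)
            _ = M + 2 * A1 := by ring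
        · rw [norm_smul, norm_mul]
          refine mul_le_mul_of_nonneg_right (mul_le_mul (hB x).1 ?_ (norm_nonneg _) hB0)
            (norm_nonneg _)
          have h1 := hdb j x
          have h3 := hA2' _ hx
          exact (norm_sub_le _ _).trans ((add_le_add h1 h3).trans (by linarith))
      · filter_upwards [hUlim'] with x hx
        have := (hx.1.smul_const (gradient ζ x)).add ((hx.2.const_mul (ζ x)).smul_const (G x))
        simpa using this
    have hTlim : Tendsto (fun j => eLpNorm (T j) (ENNReal.ofReal p) μ) atTop (𝓝 0) := by
      have h := ENNReal.Tendsto.const_mul (a := ENNReal.ofReal (B * (1 + A2))) hUgrad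
        (Or.inr ENNReal.ofReal_ne_top)
      rw [mul_zero] at h
      refine tendsto_of_tendsto_of_tendsto_of_le_of_le tendsto_const_nhds h (fun _ => zero_le)
        fun j => ?_
      refine eLpNorm_le_mul_eLpNorm_of_ae_le_mul (Eventually.of_forall fun x => ?_) _
      rw [hT, norm_smul, norm_mul]
      exact mul_le_mul_of_nonneg_right (mul_le_mul (hB x).1 (hdb j x) (norm_nonneg _) hB0)
        (norm_nonneg _)
    have hsum := hRlim.add hTlim
    rw [add_zero] at hsum
    refine tendsto_of_tendsto_of_tendsto_of_le_of_le tendsto_const_nhds hsum (fun _ => zero_le)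
      fun j => ?_
    have hsupp : Function.support (fun x => gradient (Φ j) x - gradMulComp ζ u G F F' x)
        ⊆ ball 0 3 := by
      intro x hx
      by_contra h
      refine hx ?_
      have h' : x ∉ tsupport (Φ j) := fun h' => h ((hΦt j).tsupport_subset h')
      simp [hX0 x h, gradient_eq_zero_of_notMem_tsupport h']
    rw [← eLpNorm_restrict_eq_of_support_subset hsupp]
    refine le_trans (le_of_eq ?_) (eLpNorm_add_le (hRm j) (hTm j) hP1)
    congr 1
    ext1 x
    rw [hΦg]
    simp only [gradMulComp, Pi.add_apply, hR, hT]
    module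

end ChainRule

/-! ### Testing the equation and the Sobolev inequality -/

section WeakFormulation

variable {n : ℕ}

/-- This holds also where `g = 0` and `p < 2`, since the inner product vanishes there. -/
theorem norm_rpow_mul_inner_le {E : Type*} [NormedAddCommGroup E] [InnerProductSpace ℝ E]
    {p : ℝ} (g y : E) :
    ‖‖g‖ ^ (p - 2) * inner ℝ g y‖ ≤ ‖g‖ ^ (p - 1) * ‖y‖ := by
  rcases eq_or_ne g 0 with rfl | hg
  · simp only [inner_zero_left, mul_zero, norm_zero]
    positivity
  · have hg' : 0 < ‖g‖ := norm_pos_iff.2 hg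
    rw [norm_mul, Real.norm_of_nonneg (by positivity)]
    calc _ ≤ ‖g‖ ^ (p - 2) * (‖g‖ * ‖y‖) := by gcongr; exact norm_inner_le_norm g y
      _ = ‖g‖ ^ (p - 1) * ‖y‖ := by
        rw [← mul_assoc, ← Real.rpow_add_one hg'.ne']; ring_nf

theorem norm_rpow_mul_inner_self {E : Type*} [NormedAddCommGroup E] [InnerProductSpace ℝ E]
    {p : ℝ} (hp : 1 < p) (g : E) : ‖g‖ ^ (p - 2) * inner ℝ g g = ‖g‖ ^ p := by
  rcases eq_or_ne g 0 with rfl | hg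
  · simp [Real.zero_rpow (show p ≠ 0 by linarith)]
  · have hg' : 0 < ‖g‖ := norm_pos_iff.2 hg
    rw [real_inner_self_eq_norm_sq, ← Real.rpow_natCast, ← Real.rpow_add hg']
    norm_num

/-- Hölder's inequality for the pairing of the flux `|G|^{p-2} G` with a field in `L^p`. -/
theorem lintegral_flux_le {α E : Type*} [MeasurableSpace α] {μ : Measure α}
    [NormedAddCommGroup E] [InnerProductSpace ℝ E] {p : ℝ} (hp : 1 < p)
    {G Y : α → E} (hG : AEStronglyMeasurable G μ) (hY : AEStronglyMeasurable Y μ) :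
    ∫⁻ x, ‖‖G x‖ ^ (p - 2) * inner ℝ (G x) (Y x)‖ₑ ∂μ
      ≤ eLpNorm G (ENNReal.ofReal p) μ ^ (p - 1) * eLpNorm Y (ENNReal.ofReal p) μ := by
  have hp0 : 0 < p := by linarith
  have hp1 : 0 < p - 1 := by linarith
  have hP0 : ENNReal.ofReal p ≠ 0 := by simpa using hp0
  have hPr : (ENNReal.ofReal p).toReal = p := ENNReal.toReal_ofReal hp0.le
  have hc : (p / (p - 1)).HolderConjugate p := (Real.HolderConjugate.conjExponent hp).symm
  calc ∫⁻ x, ‖‖G x‖ ^ (p - 2) * inner ℝ (G x) (Y x)‖ₑ ∂μ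
      ≤ ∫⁻ x, ((fun x => ‖G x‖ₑ ^ (p - 1)) * fun x => ‖Y x‖ₑ) x ∂μ := by
        apply lintegral_mono fun x => ?_
        rw [← ofReal_norm]
        refine (ENNReal.ofReal_le_ofReal (norm_rpow_mul_inner_le (G x) (Y x))).trans ?_
        rw [ENNReal.ofReal_mul (by positivity),
          ← ENNReal.ofReal_rpow_of_nonneg (norm_nonneg _) hp1.le, ofReal_norm, ofReal_norm]
        exact le_rfl
    _ ≤ (∫⁻ x, (‖G x‖ₑ ^ (p - 1)) ^ (p / (p - 1)) ∂μ) ^ (1 / (p / (p - 1)))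
          * (∫⁻ x, ‖Y x‖ₑ ^ p ∂μ) ^ (1 / p) :=
        ENNReal.lintegral_mul_le_Lp_mul_Lq μ hc (hG.enorm.pow_const _) hY.enorm
    _ = _ := by
        rw [eLpNorm_eq_lintegral_rpow_enorm_toReal hP0 ENNReal.ofReal_ne_top,
          eLpNorm_eq_lintegral_rpow_enorm_toReal hP0 ENNReal.ofReal_ne_top, hPr,
          ← ENNReal.rpow_mul]
        congr 2
        · congr 1
          ext x
          rw [← ENNReal.rpow_mul]
          congr 1
          field_simp
        · field_simp

theorem integrable_flux {α E : Type*} [MeasurableSpace α] {μ : Measure α}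
    [NormedAddCommGroup E] [InnerProductSpace ℝ E] {p : ℝ} (hp : 1 < p)
    {G Y : α → E} (hG : MemLp G (ENNReal.ofReal p) μ) (hY : MemLp Y (ENNReal.ofReal p) μ) :
    Integrable (fun x => ‖G x‖ ^ (p - 2) * inner ℝ (G x) (Y x)) μ := by
  refine ⟨(hG.1.norm.aemeasurable.pow_const _).aestronglyMeasurable.mul (hG.1.inner hY.1), ?_⟩
  exact (lintegral_flux_le hp hG.1 hY.1).trans_lt
    (ENNReal.mul_lt_top (ENNReal.rpow_lt_top_of_nonneg (by linarith) hG.2.ne) hY.2)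

/-- A weak solution may be tested with `ζ F(u)`, `F` of class `C^1`. -/
theorem integral_flux_gradMulComp_eq_zero {p : ℝ} (hp : 1 < p)
    {u : EuclideanSpace ℝ (Fin n) → ℝ} {G : EuclideanSpace ℝ (Fin n) → EuclideanSpace ℝ (Fin n)}
    (hW : HasWeakGradient p (ball 0 4) u G) {M : ℝ} (hM0 : 0 ≤ M)
    (hM : ∀ᵐ x ∂(volume.restrict (ball 0 4)), |u x| ≤ M)
    (hsol : ∀ φ : EuclideanSpace ℝ (Fin n) → ℝ, IsTestFunction (ball 0 4) φ →
      ∫ x in ball 0 4, ‖G x‖ ^ (p - 2) * inner ℝ (G x) (gradient φ x) = 0)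
    {ζ : EuclideanSpace ℝ (Fin n) → ℝ} (hζ : IsTestFunction (ball 0 3) ζ)
    {F F' : ℝ → ℝ} (hF : ∀ t, HasDerivAt F (F' t) t) (hF' : Continuous F') :
    ∫ x in ball 0 3, ‖G x‖ ^ (p - 2) * inner ℝ (G x) (gradMulComp ζ u G F F' x) = 0 := by
  obtain ⟨hX, Φ, hΦt, -, hΦg⟩ := exists_testFunction_tendsto_mul_comp hp.le hW hM0 hM hζ hF hF'
  set X := gradMulComp ζ u G F F'
  have h3c : closedBall (0 : EuclideanSpace ℝ (Fin n)) 3 ⊆ ball 0 4 :=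
    closedBall_subset_ball (by norm_num)
  have hGL : MemLp G (ENNReal.ofReal p) (volume.restrict (ball 0 3)) :=
    (hW.memLpLoc_grad _ h3c (isCompact_closedBall _ _)).mono_measure
    (Measure.restrict_mono ball_subset_closedBall le_rfl)
  have hΦL : ∀ j, MemLp (gradient (Φ j)) (ENNReal.ofReal p) (volume.restrict (ball 0 3)) :=
    fun j => by
      have : IsFiniteMeasure (volume.restrict (ball (0 : EuclideanSpace ℝ (Fin n)) 3)) :=
        ⟨by rw [Measure.restrict_apply_univ]; exact measure_ball_lt_top⟩
      obtain ⟨B, hB⟩ := (hΦt j).exists_bound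
      exact MemLp.of_bound (continuous_gradient (hΦt j).smooth).aestronglyMeasurable B
        (Eventually.of_forall fun x => (hB x).2)
  have hΦ0 : ∀ j, ∫ x in ball 0 3, ‖G x‖ ^ (p - 2) * inner ℝ (G x) (gradient (Φ j) x) = 0 := by
    intro j
    rw [← hsol (Φ j) ⟨(hΦt j).smooth, (hΦt j).hasCompactSupport,
      (hΦt j).tsupport_subset.trans (ball_subset_ball (by norm_num))⟩]
    refine (setIntegral_eq_of_subset_of_forall_sdiff_eq_zero measurableSet_ball
      (ball_subset_ball (by norm_num)) fun x hx => ?_).symm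
    rw [gradient_eq_zero_of_notMem_tsupport fun h => hx.2 ((hΦt j).tsupport_subset h)]
    simp
  have hb : ∀ j, ‖∫ x in ball 0 3, ‖G x‖ ^ (p - 2) * inner ℝ (G x) (X x)‖ₑ
      ≤ eLpNorm G (ENNReal.ofReal p) (volume.restrict (ball 0 3)) ^ (p - 1)
        * eLpNorm (fun x => gradient (Φ j) x - X x) (ENNReal.ofReal p) volume := by
    intro j
    have e : ∫ x in ball 0 3, ‖G x‖ ^ (p - 2) * inner ℝ (G x) (gradient (Φ j) x - X x)
        = - ∫ x in ball 0 3, ‖G x‖ ^ (p - 2) * inner ℝ (G x) (X x) := by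
      simp_rw [inner_sub_right, mul_sub]
      rw [integral_sub (integrable_flux hp hGL (hΦL j)) (integrable_flux hp hGL (hX.restrict _)),
        hΦ0, zero_sub]
    rw [← enorm_neg, ← e]
    refine (enorm_integral_le_lintegral_enorm _).trans ((lintegral_flux_le hp hGL.1
      ((hΦL j).1.sub hX.1.restrict)).trans ?_)
    gcongr
    exact eLpNorm_mono_measure _ Measure.restrict_le_self
  have hlim := ENNReal.Tendsto.const_mul
    (a := eLpNorm G (ENNReal.ofReal p) (volume.restrict (ball 0 3)) ^ (p - 1)) hΦg
    (Or.inr (ENNReal.rpow_lt_top_of_nonneg (by linarith) hGL.2.ne).ne)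
  rw [mul_zero] at hlim
  have := ge_of_tendsto' hlim hb
  simpa using this

/-- The Gagliardo-Nirenberg-Sobolev inequality for `ζ F(u)`, `F` of class `C^1`. -/
theorem eLpNorm_mul_comp_le {p s : ℝ} (hp : 1 ≤ p) (hn : 0 < n) (hs : 0 < s)
    (hsp : s⁻¹ = p⁻¹ - (n : ℝ)⁻¹)
    {u : EuclideanSpace ℝ (Fin n) → ℝ} {G : EuclideanSpace ℝ (Fin n) → EuclideanSpace ℝ (Fin n)}
    (hW : HasWeakGradient p (ball 0 4) u G) {M : ℝ} (hM0 : 0 ≤ M)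
    (hM : ∀ᵐ x ∂(volume.restrict (ball 0 4)), |u x| ≤ M)
    {ζ : EuclideanSpace ℝ (Fin n) → ℝ} (hζ : IsTestFunction (ball 0 3) ζ)
    {F F' : ℝ → ℝ} (hF : ∀ t, HasDerivAt F (F' t) t) (hF' : Continuous F') :
    eLpNorm (fun x => ζ x * F (u x)) (ENNReal.ofReal s) volume
      ≤ SNormLESNormFDerivOfEqConst ℝ (volume : Measure (EuclideanSpace ℝ (Fin n))) p.toNNReal
        * eLpNorm (gradMulComp ζ u G F F') (ENNReal.ofReal p) volume := by
  obtain ⟨hX, Φ, hΦt, hΦlim, hΦg⟩ := exists_testFunction_tendsto_mul_comp hp hW hM0 hM hζ hF hF'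
  set X := gradMulComp ζ u G F F'
  set S := SNormLESNormFDerivOfEqConst ℝ (volume : Measure (EuclideanSpace ℝ (Fin n))) p.toNNReal
  have hP1 : 1 ≤ ENNReal.ofReal p := by simpa using hp
  have hj : ∀ j, eLpNorm (Φ j) (ENNReal.ofReal s) volume ≤ S *
      (eLpNorm X (ENNReal.ofReal p) volume
        + eLpNorm (fun x => gradient (Φ j) x - X x) (ENNReal.ofReal p) volume) := by
    intro j
    have h := eLpNorm_le_eLpNorm_fderiv_of_eq (F := ℝ)
      (volume : Measure (EuclideanSpace ℝ (Fin n))) (u := Φ j)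
      ((hΦt j).smooth.of_le (by simp)) (hΦt j).hasCompactSupport (p := p.toNNReal)
      (p' := s.toNNReal) (by simpa using hp) (by simpa using hn)
      (by rw [Real.coe_toNNReal _ hs.le, NNReal.coe_inv, Real.coe_toNNReal _ (by linarith), hsp]; simp)
    refine h.trans ?_
    gcongr
    have e : eLpNorm (fderiv ℝ (Φ j)) (ENNReal.ofReal p) volume
        = eLpNorm (gradient (Φ j)) (ENNReal.ofReal p) volume :=
      eLpNorm_congr_norm_ae (Eventually.of_forall fun x => by
        unfold gradient; rw [LinearIsometryEquiv.norm_map])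
    refine e.le.trans ?_
    have hgm : AEStronglyMeasurable (gradient (Φ j)) volume :=
      (continuous_gradient (hΦt j).smooth).aestronglyMeasurable
    refine le_trans (le_of_eq ?_) (eLpNorm_add_le hX.1 (hgm.sub hX.1) hP1)
    congr 1
    ext1 x
    simp
  have hlim := ENNReal.Tendsto.const_mul (a := (S : ℝ≥0∞))
    (hΦg.const_add (eLpNorm X (ENNReal.ofReal p) volume)) (Or.inr ENNReal.coe_ne_top)
  rw [add_zero] at hlim
  refine (Lp.eLpNorm_lim_le_liminf_eLpNorm
    (fun j => (hΦt j).smooth.continuous.aestronglyMeasurable) _ hΦlim).trans ?_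
  rw [← hlim.liminf_eq]
  exact liminf_le_liminf (Eventually.of_forall hj)

end WeakFormulation

/-! ### Cut-off functions -/

section Cutoff

/-- Cut-off functions between concentric balls. The power `1 - 1/p` of `ζ` in the gradient bound
lets the gradient terms be absorbed; it comes from raising a cut-off to a power `N ≥ p`. -/
theorem exists_cutoff (n : ℕ) {p : ℝ} (hp : 1 < p) :
    ∃ L : ℝ, 0 < L ∧ ∀ r R : ℝ, 1 ≤ r → r < R → R < 3 →
      ∃ ζ : EuclideanSpace ℝ (Fin n) → ℝ, IsTestFunction (ball 0 3) ζ ∧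
        (∀ x, 0 ≤ ζ x) ∧ (∀ x, ζ x ≤ 1) ∧ (∀ x ∈ ball 0 r, ζ x = 1) ∧
        (∀ x, x ∉ ball 0 R → ζ x = 0) ∧
        ∀ x, ‖gradient ζ x‖ ≤ L / (R - r) * ζ x ^ (1 - 1 / p) := by
  obtain ⟨B, hB⟩ : ∃ B, ∀ t, |deriv Real.smoothTransition t| ≤ B := by
    have hc : Continuous (deriv Real.smoothTransition) :=
      (Real.smoothTransition.contDiff (n := 1)).continuous_deriv le_rfl
    obtain ⟨B, hB⟩ := (isCompact_Icc (a := (0 : ℝ)) (b := 1)).exists_bound_of_continuousOn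
      hc.continuousOn
    refine ⟨B, fun t => ?_⟩
    have hB0 : 0 ≤ B := (norm_nonneg _).trans (hB 0 (by simp))
    by_cases ht : t ∈ Set.Icc (0 : ℝ) 1
    · exact hB t ht
    · have h0 : deriv Real.smoothTransition t = 0 := by
        rcases lt_or_ge t 0 with h | h
        · have : Real.smoothTransition =ᶠ[𝓝 t] fun _ => 0 := by
            filter_upwards [Iio_mem_nhds h] with s hs
            exact Real.smoothTransition.zero_of_nonpos (le_of_lt hs)
          rw [this.deriv_eq]; simp
        · have h1 : 1 < t := by
            by_contra hc'; exact ht ⟨h, not_lt.1 hc'⟩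
          have : Real.smoothTransition =ᶠ[𝓝 t] fun _ => 1 := by
            filter_upwards [Ioi_mem_nhds h1] with s hs
            exact Real.smoothTransition.one_of_one_le (le_of_lt hs)
          rw [this.deriv_eq]; simp
      rw [h0]; simpa using hB0
  have hB0 : 0 ≤ B := (abs_nonneg _).trans (hB 0)
  -- `N ≥ p` makes `N - 1 ≥ N (1 - 1/p)`
  set N : ℕ := ⌈p⌉₊ with hN
  have hpN : p ≤ N := Nat.le_ceil p
  have hN1 : 1 ≤ N := by
    have : (1 : ℝ) < N := hp.trans_le hpN
    exact_mod_cast this.le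
  have hp0 : 0 < p := by linarith
  refine ⟨2 * N * B + 1, by positivity, fun r R hr hrR hR3 => ?_⟩
  have hD : 0 < R ^ 2 - r ^ 2 := by nlinarith
  set g : EuclideanSpace ℝ (Fin n) → ℝ := fun x => (R ^ 2 - ‖x‖ ^ 2) / (R ^ 2 - r ^ 2) with hg
  have hgs : ContDiff ℝ ∞ g := (contDiff_const.sub (contDiff_norm_sq ℝ)).div_const _
  set η : EuclideanSpace ℝ (Fin n) → ℝ := fun x => Real.smoothTransition (g x) with hη
  have hηs : ContDiff ℝ ∞ η := Real.smoothTransition.contDiff.comp hgs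
  have hη0 : ∀ x, 0 ≤ η x := fun x => Real.smoothTransition.nonneg _
  have hη1 : ∀ x, η x ≤ 1 := fun x => Real.smoothTransition.le_one _
  have hηz : ∀ x, x ∉ ball (0 : EuclideanSpace ℝ (Fin n)) R → η x = 0 := by
    intro x hx
    have hx' : R ≤ ‖x‖ := by simpa using hx
    apply Real.smoothTransition.zero_of_nonpos
    apply div_nonpos_of_nonpos_of_nonneg _ hD.le
    nlinarith
  have hηo : ∀ x ∈ ball (0 : EuclideanSpace ℝ (Fin n)) r, η x = 1 := by
    intro x hx
    have hx' : ‖x‖ < r := by simpa using hx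
    apply Real.smoothTransition.one_of_one_le
    rw [le_div_iff₀ hD]
    nlinarith [norm_nonneg x]
  have hsub : Function.support (fun x => η x ^ N) ⊆ closedBall 0 R := by
    intro x hx
    by_contra h
    refine hx ?_
    have := hηz x (fun h' => h (ball_subset_closedBall h'))
    simp only [this]
    exact zero_pow (by omega)
  have htsub : tsupport (fun x => η x ^ N) ⊆ closedBall 0 R :=
    closure_minimal hsub isClosed_closedBall
  refine ⟨fun x => η x ^ N, ⟨hηs.pow N,
    HasCompactSupport.of_support_subset_isCompact (isCompact_closedBall 0 R) hsub,
    htsub.trans (closedBall_subset_ball hR3)⟩, fun x => pow_nonneg (hη0 x) _,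
    fun x => pow_le_one₀ (hη0 x) (hη1 x), fun x hx => by simp [hηo x hx],
    fun x hx => by simp only [hηz x hx]; exact zero_pow (by omega), fun x => ?_⟩
  by_cases hxR : x ∈ closedBall (0 : EuclideanSpace ℝ (Fin n)) R
  swap
  · rw [gradient_eq_zero_of_notMem_tsupport fun h => hxR (htsub h), norm_zero]
    have := hη0 x
    have : 0 < R - r := by linarith
    positivity
  have hxR' : ‖x‖ ≤ R := by simpa using hxR
  have h1 : HasFDerivAt g ((R ^ 2 - r ^ 2)⁻¹ • -((2 : ℝ) • innerSL ℝ x)) x := by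
    have := ((hasStrictFDerivAt_norm_sq x).hasFDerivAt.const_sub (R ^ 2)).mul_const
      (R ^ 2 - r ^ 2)⁻¹
    simpa [hg, div_eq_mul_inv, two_smul] using this
  have h2 : HasDerivAt Real.smoothTransition (deriv Real.smoothTransition (g x)) (g x) :=
    ((Real.smoothTransition.contDiff (n := 1)).differentiable one_ne_zero _).hasDerivAt
  have h3 := (h2.comp_hasFDerivAt x h1).pow N
  have h4 : ‖gradient (fun x => η x ^ N) x‖ = ‖fderiv ℝ (fun x => η x ^ N) x‖ := by
    unfold gradient; rw [LinearIsometryEquiv.norm_map]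
  rw [h4]
  have h5 : fderiv ℝ (fun x => η x ^ N) x = _ := h3.fderiv
  rw [h5]
  have h6 : ‖(R ^ 2 - r ^ 2)⁻¹ • -((2 : ℝ) • innerSL ℝ x)‖ ≤ 2 / (R - r) := by
    rw [norm_smul, norm_neg, norm_smul, innerSL_apply_norm, norm_inv, Real.norm_of_nonneg hD.le,
      Real.norm_of_nonneg (by norm_num : (0:ℝ) ≤ 2), inv_mul_eq_div,
      div_le_div_iff₀ hD (by linarith)]
    nlinarith [mul_nonneg (sub_nonneg.2 hrR.le) (sub_nonneg.2 hxR'),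
      mul_nonneg (sub_nonneg.2 hrR.le) (show 0 ≤ r by linarith)]
  have h7 : η x ^ (N - 1) ≤ (η x ^ N) ^ (1 - 1 / p) := by
    rw [← Real.rpow_natCast, ← Real.rpow_natCast, ← Real.rpow_mul (hη0 x)]
    rcases (hη0 x).eq_or_lt with h0 | h0
    · rw [← h0]
      rcases Nat.eq_or_lt_of_le hN1 with hN' | hN'
      · exfalso
        have : (N : ℝ) = 1 := by exact_mod_cast hN'.symm
        linarith
      · rw [Real.zero_rpow]
        · positivity
        · have : 0 < N - 1 := by omega
          exact_mod_cast this.ne'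
    · apply Real.rpow_le_rpow_of_exponent_ge h0 (hη1 x)
      rw [Nat.cast_sub hN1]
      have : 1 ≤ N / p := by rwa [le_div_iff₀ hp0, one_mul]
      have e : (N : ℝ) * (1 - 1 / p) = N - N / p := by ring
      rw [e]; push_cast; linarith
  have hRr : 0 < R - r := by linarith
  have h8 : ‖(N : ℝ) * η x ^ (N - 1)‖ = N * η x ^ (N - 1) :=
    Real.norm_of_nonneg (mul_nonneg N.cast_nonneg (pow_nonneg (hη0 x) _))
  rw [nsmul_eq_mul, norm_smul, norm_smul]
  refine (mul_le_mul_of_nonneg_right h8.le (by positivity)).trans ?_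
  calc (N : ℝ) * η x ^ (N - 1) * (‖deriv Real.smoothTransition (g x)‖ *
          ‖(R ^ 2 - r ^ 2)⁻¹ • -((2 : ℝ) • innerSL ℝ x)‖)
      ≤ (N : ℝ) * (η x ^ N) ^ (1 - 1 / p) * (B * (2 / (R - r))) := by
        have := hη0 x
        gcongr
        exact hB _
    _ = (2 * N * B) / (R - r) * (η x ^ N) ^ (1 - 1 / p) := by ring
    _ ≤ _ := by
        have := hη0 x
        gcongr
        linarith

end Cutoff

/-! ### The Caccioppoli inequality -/

section Energy

variable {n : ℕ}

theorem hasDerivAt_max_sub_rpow {a : ℝ} (ha : 1 < a) (k t : ℝ) :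
    HasDerivAt (fun t => max (t - k) 0 ^ a) (a * max (t - k) 0 ^ (a - 1)) t := by
  have ha0 : a ≠ 0 := by linarith
  have ha1 : a - 1 ≠ 0 := by linarith
  have hr : k ≤ t → HasDerivWithinAt (fun t => max (t - k) 0 ^ a) (a * max (t - k) 0 ^ (a - 1))
      (Set.Ici k) t := by
    intro ht
    have h1 : HasDerivAt (fun t => (t - k) ^ a) (a * (t - k) ^ (a - 1)) t := by
      simpa using ((hasDerivAt_id t).sub_const k).rpow_const (p := a) (Or.inr ha.le)
    rw [max_eq_left (sub_nonneg.2 ht)]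
    refine h1.hasDerivWithinAt.congr (fun s hs => ?_) ?_
    · rw [max_eq_left (sub_nonneg.2 hs)]
    · rw [max_eq_left (sub_nonneg.2 ht)]
  have hl : t ≤ k → HasDerivWithinAt (fun t => max (t - k) 0 ^ a) (a * max (t - k) 0 ^ (a - 1))
      (Set.Iic k) t := by
    intro ht
    rw [max_eq_right (sub_nonpos.2 ht), Real.zero_rpow ha1, mul_zero]
    refine (hasDerivWithinAt_const t (Set.Iic k) (0 : ℝ)).congr (fun s hs => ?_) ?_
    · rw [max_eq_right (sub_nonpos.2 hs), Real.zero_rpow ha0]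
    · rw [max_eq_right (sub_nonpos.2 ht), Real.zero_rpow ha0]
  rcases lt_trichotomy t k with h | h | h
  · exact (hl h.le).hasDerivAt (Iic_mem_nhds h)
  · have := (hl h.le).union (hr h.ge)
    rwa [Set.Iic_union_Ici, hasDerivWithinAt_univ] at this
  · exact (hr h.le).hasDerivAt (Ici_mem_nhds h)

theorem continuous_mul_max_sub_rpow {a : ℝ} (ha : 1 < a) (k : ℝ) :
    Continuous (fun t => a * max (t - k) 0 ^ (a - 1)) :=
  continuous_const.mul (((continuous_id.sub continuous_const).max continuous_const).rpow_const
    fun _ => Or.inr (by linarith))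

/-- Young's inequality with the exponents `p / (p - 1)` and `p`. -/
theorem sq_mul_rpow_mul_le {p v g z L : ℝ} (hp : 1 < p) (hv : 0 ≤ v) (hg : 0 ≤ g) (hz : 0 ≤ z)
    (hL : 0 ≤ L) :
    v ^ (2 : ℝ) * g ^ (p - 1) * (L * z ^ (1 - 1 / p)) ≤ z * v * g ^ p + L ^ p * v ^ (p + 1) := by
  have hp0 : 0 < p := by linarith
  have hp1 : 0 < p - 1 := by linarith
  have hc : (p / (p - 1)).HolderConjugate p := (Real.HolderConjugate.conjExponent hp).symm
  have hy := Real.young_inequality_of_nonneg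
    (a := (z * v) ^ (1 - 1 / p) * g ^ (p - 1)) (b := L * v ^ (1 + 1 / p))
    (by positivity) (by positivity) hc
  have e1 : ((z * v) ^ (1 - 1 / p) * g ^ (p - 1)) ^ (p / (p - 1)) = z * v * g ^ p := by
    rw [Real.mul_rpow (by positivity) (by positivity), ← Real.rpow_mul (by positivity),
      ← Real.rpow_mul hg]
    have h1 : (1 - 1 / p) * (p / (p - 1)) = 1 := by field_simp
    have h2 : (p - 1) * (p / (p - 1)) = p := by field_simp
    rw [h1, h2, Real.rpow_one]
  have e2 : (L * v ^ (1 + 1 / p)) ^ p = L ^ p * v ^ (p + 1) := by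
    rw [Real.mul_rpow hL (by positivity), ← Real.rpow_mul hv]
    congr 2
    field_simp
  have e3 : (z * v) ^ (1 - 1 / p) * g ^ (p - 1) * (L * v ^ (1 + 1 / p))
      = v ^ (2 : ℝ) * g ^ (p - 1) * (L * z ^ (1 - 1 / p)) := by
    rw [Real.mul_rpow hz hv]
    have : v ^ (2 : ℝ) = v ^ (1 - 1 / p) * v ^ (1 + 1 / p) := by
      rw [← Real.rpow_add' hv (by norm_num)]
      norm_num
    rw [this]; ring
  rw [e1, e2, e3] at hy
  have hpp : 1 ≤ p / (p - 1) := by rw [le_div_iff₀ hp1]; linarith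
  have h1 : z * v * g ^ p / (p / (p - 1)) ≤ z * v * g ^ p := div_le_self (by positivity) hpp
  have h2 : L ^ p * v ^ (p + 1) / p ≤ L ^ p * v ^ (p + 1) := div_le_self (by positivity) hp.le
  linarith

/-- The pointwise form of the Caccioppoli inequality. On the left is the gradient of
`ζ v^{1+1/p}`, on the right the flux tested with the gradient of `ζ v^2`; here `z`, `D` and `g` are
the values of `ζ`, `∇ζ` and `∇u`. -/
theorem norm_rpow_le_flux_add {E : Type*} [NormedAddCommGroup E] [InnerProductSpace ℝ E]
    {p v z L : ℝ} {g D : E} (hp : 1 < p) (hv : 0 ≤ v) (hz : 0 ≤ z) (hz1 : z ≤ 1) (hL : 0 ≤ L)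
    (hD : ‖D‖ ≤ L * z ^ (1 - 1 / p)) :
    ‖v ^ (1 + 1 / p) • D + (z * ((1 + 1 / p) * v ^ (1 + 1 / p - 1))) • g‖ ^ p
      ≤ 4 ^ p * (‖g‖ ^ (p - 2) * inner ℝ g (v ^ (2 : ℝ) • D + (z * (2 * v ^ ((2 : ℝ) - 1))) • g))
        + (2 ^ p + 4 ^ p) * (L ^ p * v ^ (p + 1)) := by
  have hp0 : 0 < p := by linarith
  have hg := norm_nonneg g
  have hyoung := sq_mul_rpow_mul_le hp hv hg hz hL
  -- the flux term controls the weighted energy `z v |g|^p`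
  have hflux : z * v * ‖g‖ ^ p - L ^ p * v ^ (p + 1) ≤
      ‖g‖ ^ (p - 2) * inner ℝ g (v ^ (2 : ℝ) • D + (z * (2 * v ^ ((2 : ℝ) - 1))) • g) := by
    have e : ‖g‖ ^ (p - 2) * inner ℝ g (v ^ (2 : ℝ) • D + (z * (2 * v ^ ((2 : ℝ) - 1))) • g)
        = v ^ (2 : ℝ) * (‖g‖ ^ (p - 2) * inner ℝ g D) + 2 * (z * v * ‖g‖ ^ p) := by
      rw [← norm_rpow_mul_inner_self hp g, inner_add_right, inner_smul_right, inner_smul_right,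
        show (2 : ℝ) - 1 = 1 by norm_num, Real.rpow_one]
      ring
    have h1 : -(‖g‖ ^ (p - 1) * (L * z ^ (1 - 1 / p))) ≤ ‖g‖ ^ (p - 2) * inner ℝ g D := by
      refine le_trans (neg_le_neg ?_) (neg_abs_le _)
      exact (norm_rpow_mul_inner_le g D).trans (mul_le_mul_of_nonneg_left hD (by positivity))
    have h2 := mul_le_mul_of_nonneg_left h1 (show 0 ≤ v ^ (2 : ℝ) by positivity)
    rw [e]
    linarith
  set a := L * v ^ (1 + 1 / p) with ha
  set b := 2 * (z * v ^ (1 / p) * ‖g‖) with hb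
  have ha0 : 0 ≤ a := by positivity
  have hb0 : 0 ≤ b := by positivity
  have hnorm : ‖v ^ (1 + 1 / p) • D + (z * ((1 + 1 / p) * v ^ (1 + 1 / p - 1))) • g‖ ≤ a + b := by
    refine (norm_add_le _ _).trans (add_le_add ?_ ?_)
    · rw [norm_smul, Real.norm_of_nonneg (by positivity), mul_comm, ha]
      gcongr
      refine hD.trans (mul_le_of_le_one_right hL (Real.rpow_le_one hz hz1 ?_))
      have : 1 / p ≤ 1 := by rw [div_le_one hp0]; exact hp.le
      linarith
    · rw [norm_smul, Real.norm_of_nonneg (by positivity), show 1 + 1 / p - 1 = 1 / p by ring]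
      have h1 : 1 / p ≤ 1 := by rw [div_le_one hp0]; exact hp.le
      calc z * ((1 + 1 / p) * v ^ (1 / p)) * ‖g‖ ≤ z * ((1 + 1) * v ^ (1 / p)) * ‖g‖ := by gcongr
        _ = b := by rw [hb]; ring
  have hmax : (a + b) ^ p ≤ 2 ^ p * (a ^ p + b ^ p) := by
    have h1 : a + b ≤ 2 * max a b := by
      linarith [le_max_left a b, le_max_right a b]
    calc (a + b) ^ p ≤ (2 * max a b) ^ p := by gcongr
      _ = 2 ^ p * max a b ^ p := Real.mul_rpow (by norm_num) (le_max_of_le_left ha0)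
      _ ≤ _ := by
        gcongr
        rcases le_total a b with h | h
        · rw [max_eq_right h]; linarith [Real.rpow_nonneg ha0 p]
        · rw [max_eq_left h]; linarith [Real.rpow_nonneg hb0 p]
  have hap : a ^ p = L ^ p * v ^ (p + 1) := by
    rw [ha, Real.mul_rpow hL (by positivity), ← Real.rpow_mul hv]
    congr 2
    field_simp
  have hbp : b ^ p ≤ 2 ^ p * (z * v * ‖g‖ ^ p) := by
    rw [hb, Real.mul_rpow (by norm_num) (by positivity), Real.mul_rpow (by positivity) hg,
      Real.mul_rpow hz (by positivity), ← Real.rpow_mul hv, one_div, inv_mul_cancel₀ hp0.ne',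
      Real.rpow_one]
    gcongr
    exact Real.rpow_le_self_of_le_one hz hz1 hp.le
  have h42 : (4 : ℝ) ^ p = 2 ^ p * 2 ^ p := by
    rw [← Real.mul_rpow (by norm_num) (by norm_num)]; norm_num
  calc _ ≤ (a + b) ^ p := by gcongr
    _ ≤ 2 ^ p * (a ^ p + b ^ p) := hmax
    _ ≤ 2 ^ p * (L ^ p * v ^ (p + 1) + 2 ^ p * (z * v * ‖g‖ ^ p)) := by rw [hap]; gcongr
    _ = 2 ^ p * (L ^ p * v ^ (p + 1)) + 4 ^ p * (z * v * ‖g‖ ^ p) := by rw [h42]; ring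
    _ ≤ _ := by
      have := mul_le_mul_of_nonneg_left hflux (show (0 : ℝ) ≤ 4 ^ p by positivity)
      linarith

theorem integrableOn_max_sub_rpow {Ω : Set (EuclideanSpace ℝ (Fin n))} {q M : ℝ} (hq : 0 ≤ q)
    {u : EuclideanSpace ℝ (Fin n) → ℝ} (hΩ : volume Ω ≠ ⊤)
    (hu : AEStronglyMeasurable u (volume.restrict Ω))
    (hM : ∀ᵐ x ∂(volume.restrict Ω), |u x| ≤ M) (k : ℝ) :
    IntegrableOn (fun x => max (u x - k) 0 ^ q) Ω := by
  have : IsFiniteMeasure (volume.restrict Ω) :=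
    ⟨by rw [Measure.restrict_apply_univ]; exact hΩ.lt_top⟩
  have hc : Continuous fun t : ℝ => max (t - k) 0 ^ q :=
    ((continuous_id.sub continuous_const).max continuous_const).rpow_const fun _ => Or.inr hq
  refine Integrable.of_bound (hc.comp_aestronglyMeasurable hu) ((M + |k|) ^ q) ?_
  filter_upwards [hM] with x hx
  have h0 : 0 ≤ max (u x - k) 0 := le_max_right _ _
  rw [Real.norm_of_nonneg (by positivity)]
  refine Real.rpow_le_rpow h0 (max_le ?_ ?_) hq
  · linarith [le_abs_self (u x), neg_abs_le k]
  · linarith [abs_nonneg (u x), abs_nonneg k]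

/-- The Caccioppoli inequality for the truncation `v = (u - k)⁺`, as a bound of the gradient of
`ζ v^{1+1/p}`. -/
theorem integral_norm_gradMulComp_rpow_le {p : ℝ} (hp : 1 < p)
    {u : EuclideanSpace ℝ (Fin n) → ℝ} {G : EuclideanSpace ℝ (Fin n) → EuclideanSpace ℝ (Fin n)}
    (hW : HasWeakGradient p (ball 0 4) u G) {M : ℝ} (hM0 : 0 ≤ M)
    (hM : ∀ᵐ x ∂(volume.restrict (ball 0 4)), |u x| ≤ M)
    (hsol : ∀ φ : EuclideanSpace ℝ (Fin n) → ℝ, IsTestFunction (ball 0 4) φ →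
      ∫ x in ball 0 4, ‖G x‖ ^ (p - 2) * inner ℝ (G x) (gradient φ x) = 0)
    {ζ : EuclideanSpace ℝ (Fin n) → ℝ} (hζ : IsTestFunction (ball 0 3) ζ)
    (hζ0 : ∀ x, 0 ≤ ζ x) (hζ1 : ∀ x, ζ x ≤ 1) {R L : ℝ} (hR : R < 3)
    (hζR : ∀ x, x ∉ ball 0 R → ζ x = 0) (hL : 0 ≤ L)
    (hζL : ∀ x, ‖gradient ζ x‖ ≤ L * ζ x ^ (1 - 1 / p)) (k : ℝ) :
    ∫ x, ‖gradMulComp ζ u G (fun t => max (t - k) 0 ^ (1 + 1 / p))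
        (fun t => (1 + 1 / p) * max (t - k) 0 ^ (1 + 1 / p - 1)) x‖ ^ p
      ≤ (2 ^ p + 4 ^ p) * (L ^ p * ∫ x in ball 0 R, max (u x - k) 0 ^ (p + 1)) := by
  have hp0 : 0 < p := by linarith
  have hexp : (1 : ℝ) - 1 / p ≠ 0 := by
    have : 1 / p < 1 := by rw [div_lt_one hp0]; exact hp
    linarith
  have ha : 1 < 1 + 1 / p := by have : 0 < 1 / p := by positivity
                                linarith
  set X := gradMulComp ζ u G (fun t => max (t - k) 0 ^ (1 + 1 / p))
        (fun t => (1 + 1 / p) * max (t - k) 0 ^ (1 + 1 / p - 1)) with hX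
  set Z := gradMulComp ζ u G (fun t => max (t - k) 0 ^ (2 : ℝ))
        (fun t => 2 * max (t - k) 0 ^ ((2 : ℝ) - 1)) with hZ
  have hZL : MemLp Z (ENNReal.ofReal p) volume :=
    (exists_testFunction_tendsto_mul_comp hp.le hW hM0 hM hζ
      (hasDerivAt_max_sub_rpow one_lt_two k) (continuous_mul_max_sub_rpow one_lt_two k)).1
  have hZ0 := integral_flux_gradMulComp_eq_zero hp hW hM0 hM hsol hζ
      (hasDerivAt_max_sub_rpow one_lt_two k) (continuous_mul_max_sub_rpow one_lt_two k)
  have h3c : closedBall (0 : EuclideanSpace ℝ (Fin n)) 3 ⊆ ball 0 4 :=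
    closedBall_subset_ball (by norm_num)
  have hGL : MemLp G (ENNReal.ofReal p) (volume.restrict (ball 0 3)) :=
    (hW.memLpLoc_grad _ h3c (isCompact_closedBall _ _)).mono_measure
    (Measure.restrict_mono ball_subset_closedBall le_rfl)
  have hR3 : ball (0 : EuclideanSpace ℝ (Fin n)) R ⊆ ball 0 3 := ball_subset_ball hR.le
  have huR : AEStronglyMeasurable u (volume.restrict (ball 0 R)) :=
    (hW.memLpLoc _ h3c (isCompact_closedBall _ _)).1.mono_measure
      (Measure.restrict_mono (hR3.trans ball_subset_closedBall) le_rfl)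
  have hMR : ∀ᵐ x ∂(volume.restrict (ball 0 R)), |u x| ≤ M :=
    hM.filter_mono (ae_mono (Measure.restrict_mono
      (hR3.trans (ball_subset_ball (by norm_num))) le_rfl))
  have hvint : IntegrableOn (fun x => max (u x - k) 0 ^ (p + 1)) (ball 0 R) :=
    integrableOn_max_sub_rpow (by linarith) measure_ball_lt_top.ne huR hMR k
  have hvint' : Integrable ((ball (0 : EuclideanSpace ℝ (Fin n)) R).indicator
      fun x => max (u x - k) 0 ^ (p + 1)) volume :=
    (integrable_indicator_iff measurableSet_ball).2 hvint
  have hflux := integrable_flux hp hGL (hZL.restrict (ball 0 3))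
  have hout : ∀ x, x ∉ ball (0 : EuclideanSpace ℝ (Fin n)) R → ζ x = 0 ∧ gradient ζ x = 0 := by
    intro x hx
    have h := hζL x
    rw [hζR x hx, Real.zero_rpow hexp, mul_zero] at h
    exact ⟨hζR x hx, norm_le_zero_iff.1 h⟩
  have e1 : ∫ x, ‖X x‖ ^ p = ∫ x in ball 0 3, ‖X x‖ ^ p := by
    refine (setIntegral_eq_integral_of_forall_compl_eq_zero fun x hx => ?_).symm
    have h := hout x fun h => hx (hR3 h)
    simp [hX, gradMulComp, h.1, h.2, Real.zero_rpow hp0.ne']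
  rw [e1]
  calc ∫ x in ball 0 3, ‖X x‖ ^ p
      ≤ ∫ x in ball 0 3, (4 ^ p * (‖G x‖ ^ (p - 2) * inner ℝ (G x) (Z x))
          + (2 ^ p + 4 ^ p) * (L ^ p * (ball (0 : EuclideanSpace ℝ (Fin n)) R).indicator
            (fun x => max (u x - k) 0 ^ (p + 1)) x)) := by
        refine integral_mono_of_nonneg (Eventually.of_forall fun x => by positivity)
          ((hflux.const_mul _).add ((hvint'.restrict.const_mul _).const_mul _))
          (Eventually.of_forall fun x => ?_)
        by_cases hx : x ∈ ball (0 : EuclideanSpace ℝ (Fin n)) R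
        · simp only [Set.indicator_of_mem hx]
          exact norm_rpow_le_flux_add hp (le_max_right _ _) (hζ0 x) (hζ1 x) hL (hζL x)
        · have h := hout x hx
          simp [hX, hZ, gradMulComp, h.1, h.2, Real.zero_rpow hp0.ne', hx]
    _ = _ := by
        rw [integral_add (hflux.const_mul _) ((hvint'.restrict.const_mul _).const_mul _),
          integral_const_mul, integral_const_mul, integral_const_mul, hZ0, mul_zero, zero_add,
          setIntegral_indicator measurableSet_ball, Set.inter_eq_self_of_subset_right hR3]

/-- The basic inequality of De Giorgi's iteration: the Caccioppoli inequality, the Sobolev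
inequality and Hölder's inequality on the superlevel set, combined. -/
theorem exists_integral_max_sub_rpow_le (n : ℕ) {p : ℝ} (hp : 1 < p) (hpn : p < n) :
    ∃ C : ℝ, 0 < C ∧ ∀ (u : EuclideanSpace ℝ (Fin n) → ℝ)
      (G : EuclideanSpace ℝ (Fin n) → EuclideanSpace ℝ (Fin n)) (M : ℝ),
      HasWeakGradient p (ball 0 4) u G → 0 ≤ M →
      (∀ᵐ x ∂(volume.restrict (ball 0 4)), |u x| ≤ M) →
      (∀ φ : EuclideanSpace ℝ (Fin n) → ℝ, IsTestFunction (ball 0 4) φ →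
        ∫ x in ball 0 4, ‖G x‖ ^ (p - 2) * inner ℝ (G x) (gradient φ x) = 0) →
      ∀ k r R : ℝ, 1 ≤ r → r < R → R < 3 →
        ∫ x in ball 0 r, max (u x - k) 0 ^ (p + 1) ≤
          C / (R - r) ^ p * volume.real ({x | k < u x} ∩ ball 0 R) ^ (p / n)
            * ∫ x in ball 0 R, max (u x - k) 0 ^ (p + 1) := by
  have hp0 : 0 < p := by linarith
  have hn0 : (0 : ℝ) < n := by linarith
  have hnN : 0 < n := by exact_mod_cast hn0
  obtain ⟨L, hL, hcut⟩ := exists_cutoff n hp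
  set S := SNormLESNormFDerivOfEqConst ℝ (volume : Measure (EuclideanSpace ℝ (Fin n))) p.toNNReal
  refine ⟨(S : ℝ) ^ p * ((2 ^ p + 4 ^ p) * L ^ p) + 1, by positivity, ?_⟩
  intro u G M hW hM0 hM hsol k r R hr hrR hR
  obtain ⟨ζ, hζ, hζ0, hζ1, hζr, hζR, hζL⟩ := hcut r R hr hrR hR
  have hRr : 0 < R - r := by linarith
  set a : ℝ := 1 + 1 / p with ha'
  have ha : 1 < a := by have : 0 < 1 / p := by positivity
                        linarith
  have hap : a * p = p + 1 := by rw [ha']; field_simp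
  set F : ℝ → ℝ := fun t => max (t - k) 0 ^ a with hF
  set F' : ℝ → ℝ := fun t => a * max (t - k) 0 ^ (a - 1) with hF'
  have hFd : ∀ t, HasDerivAt F (F' t) t := hasDerivAt_max_sub_rpow ha k
  have hFc' : Continuous F' := continuous_mul_max_sub_rpow ha k
  have hFc : Continuous F := continuous_iff_continuousAt.2 fun t => (hFd t).continuousAt
  set Y : ℝ → ℝ := fun ρ => ∫ x in ball (0 : EuclideanSpace ℝ (Fin n)) ρ,
    max (u x - k) 0 ^ (p + 1) with hY
  have hY0 : ∀ ρ, 0 ≤ Y ρ := fun ρ => integral_nonneg fun x =>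
    Real.rpow_nonneg (le_max_right _ _) _
  set A : Set (EuclideanSpace ℝ (Fin n)) := {x | k < u x} ∩ ball 0 R with hA
  have hAfin : volume A ≠ ⊤ := ((measure_mono Set.inter_subset_right).trans_lt
    measure_ball_lt_top).ne
  -- the Sobolev exponent of `p`
  set s : ℝ := (p⁻¹ - (n : ℝ)⁻¹)⁻¹ with hs'
  have hpn' : 0 < p⁻¹ - (n : ℝ)⁻¹ := sub_pos.2 (inv_strictAnti₀ hp0 hpn)
  have hs : 0 < s := inv_pos.2 hpn'
  have hps : p ≤ s := by
    rw [hs', le_inv_comm₀ hp0 hpn']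
    have : 0 < (n : ℝ)⁻¹ := by positivity
    linarith
  have hX := exists_testFunction_tendsto_mul_comp hp.le hW hM0 hM hζ hFd hFc'
  have hsob := eLpNorm_mul_comp_le hp.le hnN hs (by rw [hs', inv_inv]) hW hM0 hM hζ hFd hFc'
  have hcac := integral_norm_gradMulComp_rpow_le hp hW hM0 hM hsol hζ hζ0 hζ1 hR hζR
    (by positivity) hζL k
  have hXL := hX.1
  set X := gradMulComp ζ u G F F' with hXdef
  set J : ℝ := ∫ x, ‖X x‖ ^ p with hJ
  have hJ0 : 0 ≤ J := integral_nonneg fun x => by positivity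
  have hP0 : ENNReal.ofReal p ≠ 0 := by simpa using hp0
  have hPr : (ENNReal.ofReal p).toReal = p := ENNReal.toReal_ofReal hp0.le
  have h3c : closedBall (0 : EuclideanSpace ℝ (Fin n)) 3 ⊆ ball 0 4 :=
    closedBall_subset_ball (by norm_num)
  have hu3 : AEStronglyMeasurable u (volume.restrict (closedBall 0 3)) :=
    (hW.memLpLoc _ h3c (isCompact_closedBall _ _)).1
  have hr3 : ball (0 : EuclideanSpace ℝ (Fin n)) r ⊆ closedBall 0 3 :=
    (ball_subset_ball (by linarith)).trans ball_subset_closedBall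
  have hA3 : A ⊆ closedBall 0 3 := Set.inter_subset_right.trans
    ((ball_subset_ball hR.le).trans ball_subset_closedBall)
  have hMr : ∀ᵐ x ∂(volume.restrict (ball 0 r)), |u x| ≤ M :=
    hM.filter_mono (ae_mono (Measure.restrict_mono (hr3.trans h3c) le_rfl))
  have hur := hu3.mono_measure (Measure.restrict_mono hr3 le_rfl)
  have hYint : IntegrableOn (fun x => max (u x - k) 0 ^ (p + 1)) (ball 0 r) :=
    integrableOn_max_sub_rpow (by linarith) measure_ball_lt_top.ne hur hMr k
  have hFp : ∀ x, ‖F (u x)‖ ^ p = max (u x - k) 0 ^ (p + 1) := fun x => by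
    have h0 : 0 ≤ max (u x - k) 0 := le_max_right _ _
    rw [hF, Real.norm_of_nonneg (by positivity), ← Real.rpow_mul h0, hap]
  have hFL : MemLp (fun x => F (u x)) (ENNReal.ofReal p) (volume.restrict (ball 0 r)) := by
    rw [← integrable_norm_rpow_iff (hFc.comp_aestronglyMeasurable hur) hP0 ENNReal.ofReal_ne_top,
      hPr]
    simp_rw [hFp]
    exact hYint
  have c1 : eLpNorm (fun x => F (u x)) (ENNReal.ofReal p) (volume.restrict (ball 0 r))
      ≤ eLpNorm (fun x => ζ x * F (u x)) (ENNReal.ofReal p) volume := by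
    refine le_trans (le_of_eq (eLpNorm_congr_ae ?_)) (eLpNorm_mono_measure _
      (Measure.restrict_le_self (s := ball 0 r)))
    rw [EventuallyEq, ae_restrict_iff' measurableSet_ball]
    exact Eventually.of_forall fun x hx => by rw [hζr x hx, one_mul]
  have hsupp : Function.support (fun x => ζ x * F (u x)) ⊆ A := by
    intro x hx
    have h1 : ζ x ≠ 0 := left_ne_zero_of_mul hx
    have h2 : F (u x) ≠ 0 := right_ne_zero_of_mul hx
    refine ⟨?_, by by_contra h; exact h1 (hζR x h)⟩
    by_contra h
    apply h2
    have h' : u x - k ≤ 0 := sub_nonpos.2 (not_lt.1 h)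
    simp only [hF, max_eq_right h']
    exact Real.zero_rpow (by linarith)
  have c2 : eLpNorm (fun x => ζ x * F (u x)) (ENNReal.ofReal p) volume
      ≤ eLpNorm (fun x => ζ x * F (u x)) (ENNReal.ofReal s) volume
        * volume A ^ (n : ℝ)⁻¹ := by
    rw [← eLpNorm_restrict_eq_of_support_subset (p := ENNReal.ofReal p) hsupp,
      ← eLpNorm_restrict_eq_of_support_subset (p := ENNReal.ofReal s) hsupp]
    have hm : AEStronglyMeasurable (fun x => ζ x * F (u x)) (volume.restrict A) :=
      hζ.smooth.continuous.aestronglyMeasurable.mul (hFc.comp_aestronglyMeasurable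
        (hu3.mono_measure (Measure.restrict_mono hA3 le_rfl)))
    have := eLpNorm_le_eLpNorm_mul_rpow_measure_univ (ENNReal.ofReal_le_ofReal hps) hm
    rwa [hPr, ENNReal.toReal_ofReal hs.le, Measure.restrict_apply_univ,
      show 1 / p - 1 / s = (n : ℝ)⁻¹ by rw [one_div, one_div, hs', inv_inv]; ring] at this
  have c3 := c1.trans (c2.trans (mul_le_mul_left hsob _))
  rw [hFL.eLpNorm_eq_integral_rpow_norm hP0 ENNReal.ofReal_ne_top,
    hXL.eLpNorm_eq_integral_rpow_norm hP0 ENNReal.ofReal_ne_top, hPr] at c3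
  simp_rw [hFp] at c3
  change ENNReal.ofReal (Y r ^ p⁻¹) ≤ S * ENNReal.ofReal (J ^ p⁻¹) * volume A ^ (n : ℝ)⁻¹ at c3
  have c4 : Y r ^ p⁻¹ ≤ S * J ^ p⁻¹ * volume.real A ^ (n : ℝ)⁻¹ := by
    have h := ENNReal.toReal_mono (ENNReal.mul_ne_top
      (ENNReal.mul_ne_top ENNReal.coe_ne_top ENNReal.ofReal_ne_top)
      (ENNReal.rpow_ne_top_of_nonneg (by positivity) hAfin)) c3
    rw [ENNReal.toReal_ofReal (Real.rpow_nonneg (hY0 r) _), ENNReal.toReal_mul,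
      ENNReal.toReal_mul, ENNReal.toReal_ofReal (Real.rpow_nonneg hJ0 _),
      ← ENNReal.toReal_rpow] at h
    exact h
  have c5 : Y r ≤ (S : ℝ) ^ p * J * volume.real A ^ (p / n) := by
    have h := Real.rpow_le_rpow (Real.rpow_nonneg (hY0 r) _) c4 hp0.le
    rw [Real.rpow_inv_rpow (hY0 r) hp0.ne', Real.mul_rpow (by positivity) (by positivity),
      Real.mul_rpow (by positivity) (by positivity), Real.rpow_inv_rpow hJ0 hp0.ne',
      ← Real.rpow_mul measureReal_nonneg] at h
    rwa [show (n : ℝ)⁻¹ * p = p / n by ring] at h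
  have hcac' : J ≤ (2 ^ p + 4 ^ p) * ((L / (R - r)) ^ p * Y R) := hcac
  rw [Real.div_rpow hL.le hRr.le] at hcac'
  change Y r ≤ _ / (R - r) ^ p * volume.real A ^ (p / n) * Y R
  calc Y r ≤ (S : ℝ) ^ p * J * volume.real A ^ (p / n) := c5
    _ ≤ (S : ℝ) ^ p * ((2 ^ p + 4 ^ p) * (L ^ p / (R - r) ^ p * Y R))
          * volume.real A ^ (p / n) := by gcongr
    _ = ((S : ℝ) ^ p * ((2 ^ p + 4 ^ p) * L ^ p)) / (R - r) ^ p * volume.real A ^ (p / n)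
          * Y R := by ring
    _ ≤ _ := by
        have := hY0 R
        gcongr
        linarith

end Energy

/-! ### The iteration -/

section Iteration

variable {n : ℕ}

/-- Fast geometric convergence: a superlinear recursion started below a threshold decays like
`c ^ j`, where `b c^δ = 1`, despite the growing factor `b ^ j`. -/
theorem tendsto_zero_of_superlinear_recursion {y : ℕ → ℝ} {D b c δ θ : ℝ} (hy : ∀ j, 0 ≤ y j)
    (hD : 0 ≤ D) (hb : 0 ≤ b) (hc : 0 < c) (hc1 : c < 1) (hδ : 0 < δ) (hθ : 0 < θ)
    (hbc : b * c ^ δ = 1) (hDθ : D * θ ^ δ ≤ c)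
    (hrec : ∀ j, y (j + 1) ≤ D * b ^ j * y j ^ (1 + δ)) (h0 : y 0 ≤ θ) :
    Tendsto y atTop (𝓝 0) := by
  have hbd : ∀ j, y j ≤ θ * c ^ j := by
    intro j
    induction j with
    | zero => simpa using h0
    | succ j ih =>
      have h1 : (c ^ j) ^ δ = (c ^ δ) ^ j := by
        rw [← Real.rpow_natCast, ← Real.rpow_natCast, ← Real.rpow_mul hc.le,
          ← Real.rpow_mul hc.le, mul_comm]
      calc y (j + 1) ≤ D * b ^ j * y j ^ (1 + δ) := hrec j
        _ ≤ D * b ^ j * (θ * c ^ j) ^ (1 + δ) := by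
          have := hy j
          gcongr
        _ = D * θ ^ δ * (b * c ^ δ) ^ j * (θ * c ^ j) := by
          rw [Real.rpow_add (by positivity), Real.rpow_one, Real.mul_rpow hθ.le (by positivity),
            h1, mul_pow]
          ring
        _ ≤ c * 1 ^ j * (θ * c ^ j) := by rw [hbc]; gcongr
        _ = θ * c ^ (j + 1) := by ring
  have hlim : Tendsto (fun j => θ * c ^ j) atTop (𝓝 0) := by
    simpa using (tendsto_pow_atTop_nhds_zero_of_lt_one hc.le hc1).const_mul θ
  exact squeeze_zero hy hbd hlim

/-- Local boundedness: if `u⁺` is small in `L^{p+1}(B_2)` compared with `k`, then `u ≤ k` in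
`B_1`. -/
theorem exists_ae_le_of_integral_max_rpow_le (n : ℕ) {p : ℝ} (hp : 1 < p) (hpn : p < n) :
    ∃ θ : ℝ, 0 < θ ∧ ∀ (u : EuclideanSpace ℝ (Fin n) → ℝ)
      (G : EuclideanSpace ℝ (Fin n) → EuclideanSpace ℝ (Fin n)) (M : ℝ),
      HasWeakGradient p (ball 0 4) u G → 0 ≤ M →
      (∀ᵐ x ∂(volume.restrict (ball 0 4)), |u x| ≤ M) →
      (∀ φ : EuclideanSpace ℝ (Fin n) → ℝ, IsTestFunction (ball 0 4) φ →
        ∫ x in ball 0 4, ‖G x‖ ^ (p - 2) * inner ℝ (G x) (gradient φ x) = 0) →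
      ∀ k : ℝ, 0 < k → ∫ x in ball 0 2, max (u x) 0 ^ (p + 1) ≤ θ * k ^ (p + 1) →
        ∀ᵐ x ∂(volume.restrict (ball 0 1)), u x ≤ k := by
  have hp0 : 0 < p := by linarith
  have hn0 : (0 : ℝ) < n := by linarith
  obtain ⟨C, hC, hstep⟩ := exists_integral_max_sub_rpow_le n hp hpn
  set q : ℝ := p + 1 with hq
  have hq0 : 0 < q := by linarith
  set δ : ℝ := p / n with hδ'
  have hδ : 0 < δ := by positivity
  set b : ℝ := 2 ^ (p + q * δ) with hb'
  have hb : 1 < b := Real.one_lt_rpow (by norm_num) (by positivity)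
  have hb0 : 0 < b := by linarith
  set D : ℝ := C * b with hD'
  have hD : 0 < D := by positivity
  set c : ℝ := b ^ (-(1 / δ)) with hc'
  have hc : 0 < c := by positivity
  have hc1 : c < 1 := Real.rpow_lt_one_of_one_lt_of_neg hb (by simpa using hδ)
  have hbc : b * c ^ δ = 1 := by
    rw [hc', ← Real.rpow_mul hb0.le, show -(1 / δ) * δ = -1 by field_simp, Real.rpow_neg_one]
    exact mul_inv_cancel₀ hb0.ne'
  refine ⟨(c / D) ^ (1 / δ), by positivity, ?_⟩
  set θ : ℝ := (c / D) ^ (1 / δ) with hθ'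
  have hθ : 0 < θ := by positivity
  have hDθ : D * θ ^ δ ≤ c := by
    rw [hθ', ← Real.rpow_mul (by positivity), show 1 / δ * δ = 1 by field_simp, Real.rpow_one]
    apply le_of_eq; field_simp
  intro u G M hW hM0 hM hsol k hk hsmall
  have hu4 : ∀ r : ℝ, r ≤ 3 → AEStronglyMeasurable u (volume.restrict (ball 0 r)) := fun r hr =>
    (hW.memLpLoc (closedBall 0 3) (closedBall_subset_ball (by norm_num))
      (isCompact_closedBall _ _)).1.mono_measure
      (Measure.restrict_mono ((ball_subset_ball hr).trans ball_subset_closedBall) le_rfl)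
  have hM4 : ∀ r : ℝ, r ≤ 3 → ∀ᵐ x ∂(volume.restrict (ball 0 r)), |u x| ≤ M := fun r hr =>
    hM.filter_mono (ae_mono (Measure.restrict_mono (ball_subset_ball (by linarith)) le_rfl))
  have hint : ∀ l r : ℝ, r ≤ 3 → IntegrableOn (fun x => max (u x - l) 0 ^ q) (ball 0 r) :=
    fun l r hr => integrableOn_max_sub_rpow hq0.le measure_ball_lt_top.ne (hu4 r hr) (hM4 r hr) l
  have hnn : ∀ l x, 0 ≤ max (u x - l) 0 ^ q := fun l x => Real.rpow_nonneg (le_max_right _ _) _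
  have hmono : ∀ {l l' : ℝ}, l ≤ l' → ∀ x, max (u x - l') 0 ^ q ≤ max (u x - l) 0 ^ q :=
    fun {l l'} h x => Real.rpow_le_rpow (le_max_right _ _)
      (max_le_max (by linarith) le_rfl) hq0.le
  -- radii `1 + t j` and levels `k (1 - t j)`
  set t : ℕ → ℝ := fun j => (1 / 2) ^ j with ht
  have ht0 : ∀ j, 0 < t j := fun j => by positivity
  have ht1 : ∀ j, t j ≤ 1 := fun j => pow_le_one₀ (by norm_num) (by norm_num)
  have hts : ∀ j, t j - t (j + 1) = t (j + 1) := fun j => by simp only [ht, pow_succ]; ring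
  set Y : ℕ → ℝ := fun j => ∫ x in ball (0 : EuclideanSpace ℝ (Fin n)) (1 + t j),
    max (u x - k * (1 - t j)) 0 ^ q with hY
  have hY0 : ∀ j, 0 ≤ Y j := fun j => integral_nonneg fun x => hnn _ x
  have hkq : 0 < k ^ q := by positivity
  have hrec : ∀ j, Y (j + 1) / k ^ q ≤ D * b ^ j * (Y j / k ^ q) ^ (1 + δ) := by
    intro j
    have htj := ht0 (j + 1)
    have h1 := hstep u G M hW hM0 hM hsol (k * (1 - t (j + 1))) (1 + t (j + 1)) (1 + t j)
      (by linarith) (by linarith [hts j]) (by linarith [ht1 j])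
    rw [show 1 + t j - (1 + t (j + 1)) = t (j + 1) by linarith [hts j]] at h1
    set a := volume.real ({x | k * (1 - t (j + 1)) < u x} ∩
      ball (0 : EuclideanSpace ℝ (Fin n)) (1 + t j)) with ha
    have h2 : ∫ x in ball (0 : EuclideanSpace ℝ (Fin n)) (1 + t j),
        max (u x - k * (1 - t (j + 1))) 0 ^ q ≤ Y j :=
      integral_mono (hint _ _ (by linarith [ht1 j])) (hint _ _ (by linarith [ht1 j]))
        (hmono (mul_le_mul_of_nonneg_left (by linarith [hts j]) hk.le))
    -- Chebyshev's inequality on the superlevel set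
    have h3 : (k * t (j + 1)) ^ q * a ≤ Y j := by
      have hch := mul_meas_ge_le_integral_of_nonneg
        (μ := volume.restrict (ball (0 : EuclideanSpace ℝ (Fin n)) (1 + t j)))
        (Eventually.of_forall (hnn (k * (1 - t j)))) (hint (k * (1 - t j)) (1 + t j)
          (by linarith [ht1 j])) ((k * t (j + 1)) ^ q)
      refine le_trans (mul_le_mul_of_nonneg_left ?_ (by positivity)) hch
      rw [measureReal_restrict_apply' measurableSet_ball]
      refine measureReal_mono ?_ ((measure_mono Set.inter_subset_right).trans_lt
        measure_ball_lt_top).ne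
      rintro x ⟨hx, hxb⟩
      refine ⟨Real.rpow_le_rpow (by positivity) (le_max_of_le_left ?_) hq0.le, hxb⟩
      have hx' : k * (1 - t (j + 1)) < u x := hx
      have : k * t (j + 1) = k * (1 - t (j + 1)) - k * (1 - t j) := by
        rw [← mul_sub]; congr 1; linarith [hts j]
      linarith
    have h4 : a ≤ Y j / k ^ q / t (j + 1) ^ q := by
      rw [div_div, ← Real.mul_rpow hk.le htj.le, le_div_iff₀ (by positivity)]
      linarith
    have ha0 : 0 ≤ a := measureReal_nonneg
    have hYj := hY0 j
    have hbt : (t (j + 1) ^ p)⁻¹ * ((t (j + 1) ^ q)⁻¹) ^ δ = b ^ (j + 1) := by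
      have e : t (j + 1) = ((2 : ℝ) ^ (j + 1))⁻¹ := by simp [ht]
      rw [e, Real.inv_rpow (by positivity) p, Real.inv_rpow (by positivity) q, inv_inv, inv_inv,
        ← Real.rpow_mul (by positivity), ← Real.rpow_add (by positivity), hb',
        ← Real.rpow_natCast, ← Real.rpow_natCast, ← Real.rpow_mul (by positivity),
        ← Real.rpow_mul (by positivity), mul_comm]
    set w := Y j / k ^ q with hw
    have hw0 : 0 ≤ w := by positivity
    calc Y (j + 1) / k ^ q ≤ (C / t (j + 1) ^ p * a ^ δ * Y j) / k ^ q := by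
          gcongr
          exact h1.trans (mul_le_mul_of_nonneg_left h2 (by positivity))
      _ = C / t (j + 1) ^ p * a ^ δ * w := by rw [hw]; ring
      _ ≤ C / t (j + 1) ^ p * (w / t (j + 1) ^ q) ^ δ * w := by gcongr
      _ = C * ((t (j + 1) ^ p)⁻¹ * ((t (j + 1) ^ q)⁻¹) ^ δ) * (w * w ^ δ) := by
          rw [div_eq_mul_inv w, Real.mul_rpow hw0 (by positivity)]; ring
      _ = D * b ^ j * w ^ (1 + δ) := by
          rw [hbt, Real.rpow_add' hw0 (by positivity), Real.rpow_one, hD']; ring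
  have h00 : Y 0 / k ^ q ≤ θ := by
    rw [div_le_iff₀ hkq]
    refine le_trans (le_of_eq ?_) hsmall
    simp only [hY, ht, pow_zero, sub_self, mul_zero, sub_zero]
    norm_num
  have hlim := tendsto_zero_of_superlinear_recursion (fun j => div_nonneg (hY0 j) hkq.le) hD.le
    hb0.le hc hc1 hδ hθ hbc hDθ hrec h00
  have hYlim : Tendsto Y atTop (𝓝 0) := by
    have := hlim.mul_const (k ^ q)
    rw [zero_mul] at this
    exact this.congr fun j => div_mul_cancel₀ _ hkq.ne'
  have hle : ∀ j, ∫ x in ball (0 : EuclideanSpace ℝ (Fin n)) 1, max (u x - k) 0 ^ q ≤ Y j := by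
    intro j
    have h3 : 1 + t j ≤ 3 := by linarith [ht1 j]
    calc _ ≤ ∫ x in ball (0 : EuclideanSpace ℝ (Fin n)) 1, max (u x - k * (1 - t j)) 0 ^ q :=
          integral_mono (hint _ _ (by norm_num)) (hint _ _ (by norm_num))
            (hmono (by nlinarith [ht0 j]))
      _ ≤ Y j := setIntegral_mono_set (hint _ _ h3) (Eventually.of_forall fun x => hnn _ x)
          (ball_subset_ball (by linarith [ht0 j])).eventuallyLE
  have hzero : ∫ x in ball (0 : EuclideanSpace ℝ (Fin n)) 1, max (u x - k) 0 ^ q = 0 :=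
    le_antisymm (ge_of_tendsto' hYlim hle) (integral_nonneg fun x => hnn _ x)
  rw [integral_eq_zero_iff_of_nonneg (fun x => hnn _ x) (hint _ _ (by norm_num))] at hzero
  filter_upwards [hzero] with x hx
  by_contra h
  have h' : 0 < u x - k := sub_pos.2 (not_le.1 h)
  have : 0 < max (u x - k) 0 ^ q := Real.rpow_pos_of_pos (lt_max_of_lt_left h') _
  exact this.ne' hx

/-- Null sets `A` are excluded, as the real-valued essential supremum is a junk value there. -/
theorem supPos_le {A : Set (EuclideanSpace ℝ (Fin n))} (hA : volume A ≠ 0)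
    {u : EuclideanSpace ℝ (Fin n) → ℝ} {k : ℝ} (hk : 0 ≤ k)
    (h : ∀ᵐ x ∂(volume.restrict A), u x ≤ k) : supPos A u ≤ k := by
  have : NeZero (volume.restrict A) := ⟨by simpa [Measure.restrict_eq_zero] using hA⟩
  exact essSup_le_of_ae_le k (h.mono fun x hx => max_le hx hk)
    (isCoboundedUnder_le_of_le _ fun x => le_max_right (u x) 0)

theorem ae_le_supPos {A : Set (EuclideanSpace ℝ (Fin n))}
    {u : EuclideanSpace ℝ (Fin n) → ℝ} (hu : EssBoundedOn A u) :
    ∀ᵐ x ∂(volume.restrict A), max (u x) 0 ≤ supPos A u := by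
  obtain ⟨M, hM⟩ := hu
  refine ae_le_essSup ⟨max M 0, ?_⟩
  rw [eventually_map]
  exact hM.mono fun x hx => max_le_max ((le_abs_self _).trans hx) le_rfl

end Iteration

end PLaplace

theorem theorem1 (n : ℕ) (p : ℝ) (hp : 1 < p) (hpn : p < (n : ℝ)) :
    ∃ α : ℝ, α = (p - 1) / ((n : ℝ) * p) ∧ 0 < α ∧ α < 1 ∧
      ∃ C : ℝ, 0 < C ∧
        ∀ u : EuclideanSpace ℝ (Fin n) → ℝ,
          PLaplace.IsWeakSolution p (ball 0 4) u →
          PLaplace.EssBoundedOn (ball 0 4) u →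
          volume.real (ball (0 : EuclideanSpace ℝ (Fin n)) 1) / 2
              ≤ volume.real ({x | u x ≤ 0} ∩ ball 0 1) →
          PLaplace.supPos (ball 0 1) u
            ≤ C * volume.real ({x | 0 < u x} ∩ ball 0 2) ^ α * PLaplace.supPos (ball 0 4) u := by
  have hp0 : 0 < p := by linarith
  have hn0 : (0 : ℝ) < n := by linarith
  set α : ℝ := (p - 1) / ((n : ℝ) * p) with hα
  have hα0 : 0 < α := div_pos (by linarith) (by positivity)
  have hα1 : α < 1 := by
    rw [hα, div_lt_one (by positivity)]
    nlinarith
  set q : ℝ := p + 1 with hq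
  have hq0 : 0 < q := by linarith
  have hαq : 0 ≤ 1 / q - α := by
    rw [hα, sub_nonneg, div_le_div_iff₀ (by positivity) hq0]
    nlinarith
  obtain ⟨θ, hθ, hbound⟩ := PLaplace.exists_ae_le_of_integral_max_rpow_le n hp hpn
  set V : ℝ := volume.real (ball (0 : EuclideanSpace ℝ (Fin n)) 2) with hV
  have hV0 : 0 < V := ENNReal.toReal_pos (measure_ball_pos _ _ (by norm_num)).ne'
    measure_ball_lt_top.ne
  refine ⟨α, rfl, hα0, hα1, (θ ^ (1 / q))⁻¹ * V ^ (1 / q - α), by positivity, ?_⟩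
  rintro u ⟨G, hW, hsol⟩ hbdd -
  set m : ℝ := PLaplace.supPos (ball 0 4) u with hm
  set a : ℝ := volume.real ({x | 0 < u x} ∩ ball 0 2) with ha
  have ha0 : 0 ≤ a := measureReal_nonneg
  have hum := PLaplace.ae_le_supPos hbdd
  have hball : ∀ r : ℝ, 0 < r → volume (ball (0 : EuclideanSpace ℝ (Fin n)) r) ≠ 0 :=
    fun r hr => (measure_ball_pos _ _ hr).ne'
  have hm0 : 0 ≤ m := by
    have : NeZero (volume.restrict (ball (0 : EuclideanSpace ℝ (Fin n)) 4)) :=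
      ⟨by simpa [Measure.restrict_eq_zero] using hball 4 (by norm_num)⟩
    obtain ⟨x, hx⟩ := hum.exists
    exact (le_max_right _ _).trans hx
  obtain ⟨M, hM⟩ := hbdd
  have hI : ∫ x in ball 0 2, max (u x) 0 ^ q ≤ m ^ q * a := by
    have e : ∫ x in ball 0 2, max (u x) 0 ^ q
        = ∫ x in {x | 0 < u x} ∩ ball 0 2, max (u x) 0 ^ q :=
      setIntegral_eq_of_subset_of_forall_sdiff_eq_zero measurableSet_ball Set.inter_subset_right
        fun x hx => by
          have : u x ≤ 0 := not_lt.1 fun h => hx.2 ⟨h, hx.1⟩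
          rw [max_eq_right this, Real.zero_rpow hq0.ne']
    rw [e]
    refine (le_abs_self _).trans ?_
    rw [← Real.norm_eq_abs]
    refine norm_setIntegral_le_of_norm_le_const_ae
      ((measure_mono Set.inter_subset_right).trans_lt measure_ball_lt_top) ?_
    have h24 : {x | 0 < u x} ∩ ball (0 : EuclideanSpace ℝ (Fin n)) 2 ⊆ ball 0 4 :=
      Set.inter_subset_right.trans (ball_subset_ball (by norm_num))
    filter_upwards [hum.filter_mono (ae_mono (Measure.restrict_mono h24 le_rfl))] with x hx
    have h0 : 0 ≤ max (u x) 0 := le_max_right _ _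
    rw [Real.norm_of_nonneg (by positivity)]
    gcongr
  have hk : PLaplace.supPos (ball 0 1) u ≤ (θ ^ (1 / q))⁻¹ * m * a ^ (1 / q) := by
    -- passing to `k` above the bound avoids the level `0`, at which the iteration degenerates
    refine le_of_forall_gt_imp_ge_of_dense fun k hk => ?_
    have hk0' : 0 ≤ (θ ^ (1 / q))⁻¹ * m * a ^ (1 / q) := by positivity
    have hk0 : 0 < k := hk0'.trans_lt hk
    refine PLaplace.supPos_le (hball 1 one_pos) hk0.le (hbound u G (max M 0) hW (le_max_right _ _)
      (hM.mono fun x hx => hx.trans (le_max_left _ _)) hsol k hk0 (hI.trans ?_))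
    have h := mul_le_mul_of_nonneg_left (Real.rpow_le_rpow hk0' hk.le hq0.le) hθ.le
    refine le_trans (le_of_eq ?_) h
    rw [Real.mul_rpow (by positivity) (by positivity), Real.mul_rpow (by positivity) hm0,
      Real.inv_rpow (by positivity), ← Real.rpow_mul hθ.le, ← Real.rpow_mul ha0,
      one_div_mul_cancel hq0.ne', Real.rpow_one, Real.rpow_one]
    field_simp
  -- lowering the exponent from `1 / q` to `α` costs a power of the measure of `B_2`
  have hav : a ^ (1 / q) ≤ V ^ (1 / q - α) * a ^ α := by
    have e : a ^ (1 / q) = a ^ (1 / q - α) * a ^ α := by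
      rw [← Real.rpow_add' ha0 (by rw [sub_add_cancel]; positivity), sub_add_cancel]
    rw [e]
    gcongr
    exact measureReal_mono Set.inter_subset_right measure_ball_lt_top.ne
  calc PLaplace.supPos (ball 0 1) u ≤ (θ ^ (1 / q))⁻¹ * m * a ^ (1 / q) := hk
    _ ≤ (θ ^ (1 / q))⁻¹ * m * (V ^ (1 / q - α) * a ^ α) := by gcongr
    _ = _ := by ring
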